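/- A lattice polygon is a two-dimensional polygon $P\subset\mathbb R^2$ that is the convex hull of finitely many points of $\mathbb Z^2$. It is called smooth if every cone of its normal fan is unimodular, i.e. generated by a part of a basis of $\mathbb Z^2$. Two lattice polygons are integrally equivalent if some affine map of $\mathbb R^2$ maps $\mathbb Z^2$ bijectively onto $\mathbb Z^2$ and maps one polygon onto the other. The (lattice) length of an edge of a lattice polygon is the number of lattice points on it minus one. (1) For every integer $N\ge 0$ there are, up to integral equivalence, only finitely many smooth lattice polygons with exactly $N+1$ lattice points on their boundary. (2) Let $P$ be a smooth lattice polygon, let $a$ be its number of vertices and $b$ the maximal length of an edge of $P$. Then the Euclidean area of $P$ satisfies $$\operatorname{vol}(P)\le\begin{cases}\tfrac12 b^2, & a=3,\\ b^2, & a=4,\\ 4^{a-4}b^2-a+4, & a\ge 5.\end{cases}$$ -/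

import Mathlib

open MeasureTheory

/-- The lattice `ℤ^d`, as a subset of `ℝ^d`. -/
def intLattice (d : ℕ) : Set (Fin d → ℝ) :=
  Set.range fun (z : Fin d → ℤ) (i : Fin d) => (z i : ℝ)

/-- A lattice polytope in `ℝ^d`: the convex hull of a nonempty finite set of lattice points. -/
def IsLatticePolytope {d : ℕ} (P : Set (Fin d → ℝ)) : Prop :=
  ∃ V : Set (Fin d → ℝ), V.Finite ∧ V.Nonempty ∧ V ⊆ intLattice d ∧ P = convexHull ℝ V

/-- A lattice polygon: a lattice polytope of full dimension in the plane. -/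
def IsLatticePolygon (P : Set (Fin 2 → ℝ)) : Prop :=
  IsLatticePolytope P ∧ affineSpan ℝ P = ⊤

/-- The nonempty faces of a polytope `P` (including `P` itself): the nonempty subsets on which
some linear functional attains its maximum over `P`. -/
def IsFace {d : ℕ} (P F : Set (Fin d → ℝ)) : Prop :=
  F.Nonempty ∧ IsExposed ℝ P F

/-- The (inner) normal cone of `P` along `F`: the functionals, written as vectors through the
standard pairing, that attain their minimum over `P` at every point of `F`.  For a vertex `u`,
the normal cone along `{u}` is the dual of the tangent cone of `P` at `u`. -/
def normalCone {d : ℕ} (P F : Set (Fin d → ℝ)) : Set (Fin d → ℝ) :=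
  {w | ∀ y ∈ F, ∀ x ∈ P, w ⬝ᵥ y ≤ w ⬝ᵥ x}

/-- The normal fan of `P`: the set of normal cones of all nonempty faces of `P`. -/
def normalFan {d : ℕ} (P : Set (Fin d → ℝ)) : Set (Set (Fin d → ℝ)) :=
  {σ | ∃ F, IsFace P F ∧ σ = normalCone P F}

/-- A cone is unimodular if it is generated by (a part of) a basis of the lattice `ℤ^d`.
The chosen part consists then of the primitive minimal generators of the cone; for a cone of
full dimension it is the whole basis. -/
def IsUnimodularCone {d : ℕ} (σ : Set (Fin d → ℝ)) : Prop :=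
  ∃ (e : Module.Basis (Fin d) ℤ (Fin d → ℤ)) (S : Set (Fin d)),
    σ = (PointedCone.hull ℝ ((fun (j : Fin d) (i : Fin d) => (e j i : ℝ)) '' S) :
      Set (Fin d → ℝ))

/-- A polytope is smooth if every cone in its normal fan is unimodular. -/
def IsSmoothPolytope {d : ℕ} (P : Set (Fin d → ℝ)) : Prop :=
  ∀ σ ∈ normalFan P, IsUnimodularCone σ

/-- Smooth lattice polygons. -/
def IsSmoothPolygon (P : Set (Fin 2 → ℝ)) : Prop :=
  IsLatticePolygon P ∧ IsSmoothPolytope P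

/-- Integral equivalence: some affine map sends `P` onto `P'` and the lattice points of the affine
span of `P` bijectively to those of the affine span of `P'`.  (Every affine map between the affine
spans is the restriction of an affine map between the ambient spaces.) -/
def IntegrallyEquivalent {d d' : ℕ} (P : Set (Fin d → ℝ)) (P' : Set (Fin d' → ℝ)) : Prop :=
  ∃ f : (Fin d → ℝ) →ᵃ[ℝ] (Fin d' → ℝ),
    Set.BijOn f (intLattice d ∩ (affineSpan ℝ P : Set (Fin d → ℝ)))
      (intLattice d' ∩ (affineSpan ℝ P' : Set (Fin d' → ℝ))) ∧
    f '' P = P'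

/-- The number of vertices of `P`. -/
noncomputable def numVertices {d : ℕ} (P : Set (Fin d → ℝ)) : ℕ :=
  (P.extremePoints ℝ).ncard

/-- The edges of `P`: its faces of dimension one. -/
def IsEdge {d : ℕ} (P F : Set (Fin d → ℝ)) : Prop :=
  IsFace P F ∧ Module.finrank ℝ (vectorSpan ℝ F) = 1

/-- The lattice length of a lattice segment: one less than its number of lattice points. -/
noncomputable def latticeLength {d : ℕ} (F : Set (Fin d → ℝ)) : ℕ :=
  (F ∩ intLattice d).ncard - 1

/-- The set of lattice lengths of the edges of `P`. -/
def edgeLengths {d : ℕ} (P : Set (Fin d → ℝ)) : Set ℕ :=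
  {l | ∃ F, IsEdge P F ∧ latticeLength F = l}

/-- The number of lattice points on the boundary of a polygon. -/
noncomputable def numBoundaryLatticePoints (P : Set (Fin 2 → ℝ)) : ℕ :=
  (frontier P ∩ intLattice 2).ncard

/-! The inner edge normals of a smooth polygon, in cyclic order, form a complete smooth fan:
consecutive generators are positively oriented lattice bases. Hence the neighbours u, q of a
generator m satisfy u + q = k m with an integer k, and with support numbers h the edge with normal m
has lattice length k h(m) - h(u) - h(q). Both claims reduce to enclosing P in a lattice
parallelogram or triangle of controlled size.

As in the classification of smooth complete toric surfaces, a fan with at least five rays has a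
generator with k = 1 (`exists_blowdown`). Deleting it (`blowdown`) leaves a smooth fan: the edge
disappears and its two neighbours are prolonged until they meet, each by the length of the lost
edge. The region only grows, and the bound on edge lengths at most doubles. With three rays left the
region is a multiple of the standard triangle; with four it is a trapezoid inside a parallelogram
(`exists_latticeBox_of_card_eq_four`). In the step from five rays to four, the two prolonged edges
are not opposite, so the parallelogram has sides at most b and 2b rather than 2b and 2b. The factor
1/2 saved there pays for the correction -a + 4.

For finiteness, N + 1 boundary points bound both the number of vertices and the edge lengths by N.
Hence P lies in a lattice square whose size depends only on N, and in adapted coordinates it is the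
convex hull of a subset of one fixed finite set. -/

/-! ### Determinants in the plane lattice -/

/-- The determinant of two vectors of the plane lattice. -/
def ldet (u v : ℤ × ℤ) : ℤ := u.1 * v.2 - u.2 * v.1

lemma ldet_self (u : ℤ × ℤ) : ldet u u = 0 := by simp only [ldet]; ring

lemma ldet_swap (u v : ℤ × ℤ) : ldet v u = -ldet u v := by simp only [ldet]; ring

lemma ldet_add_left (u v w : ℤ × ℤ) : ldet (u + v) w = ldet u w + ldet v w := by
  simp only [ldet, Prod.fst_add, Prod.snd_add]; ring

lemma ldet_add_right (u v w : ℤ × ℤ) : ldet u (v + w) = ldet u v + ldet u w := by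
  simp only [ldet, Prod.fst_add, Prod.snd_add]; ring

lemma ldet_neg_left (u v : ℤ × ℤ) : ldet (-u) v = -ldet u v := by
  simp only [ldet, Prod.fst_neg, Prod.snd_neg]; ring

lemma ldet_neg_right (u v : ℤ × ℤ) : ldet u (-v) = -ldet u v := by
  simp only [ldet, Prod.fst_neg, Prod.snd_neg]; ring

/-- Coordinates of a lattice vector with respect to a positively oriented lattice basis. -/
lemma eq_of_ldet_eq_one {a b : ℤ × ℤ} (hab : ldet a b = 1) (x : ℤ × ℤ) :
    x = (ldet x b * a.1 + ldet a x * b.1, ldet x b * a.2 + ldet a x * b.2) := by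
  simp only [ldet] at *
  ext
  · linear_combination -x.1 * hab
  · linear_combination -x.2 * hab

lemma ext_ldet {a b x y : ℤ × ℤ} (hab : ldet a b = 1) (h₁ : ldet a x = ldet a y)
    (h₂ : ldet x b = ldet y b) : x = y := by
  rw [eq_of_ldet_eq_one hab x, eq_of_ldet_eq_one hab y, h₁, h₂]

/-- Two vectors that belong to lattice bases and span the same ray are equal. -/
lemma eq_of_ldet_eq_zero {u v u' v' : ℤ × ℤ} (hu : ldet u u' = 1) (hv : ldet v v' = 1)
    (h : ldet u v = 0) (hpos : 0 < ldet v u') : v = u := by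
  have h1 := eq_of_ldet_eq_one hu v
  rw [h] at h1
  set k := ldet v u'
  have hk : k * ldet u v' = 1 := by
    rw [← hv, h1]; simp only [ldet]; ring
  have hk1 : k = 1 := by
    rcases Int.eq_one_or_neg_one_of_mul_eq_one hk with h | h <;> omega
  rw [h1, hk1]; ext <;> simp

/-- The term x y cancels, leaving a b + a y + x b = 1, where a b alone is already at least 1. This
shows that a unimodular cone has no unimodular subcone sharing a given interior vector except
itself. -/
lemma eq_of_mul_sub_mul_eq_one {a b x y : ℤ} (ha : 0 < a) (hb : 0 < b) (hx : 0 ≤ x) (hy : 0 ≤ y)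
    (h : (a + x) * (b + y) - x * y = 1) : x = 0 ∧ y = 0 ∧ a = 1 ∧ b = 1 := by
  have h1 : a * b + a * y + x * b = 1 := by linarith
  have h2 : 0 < a * b := mul_pos ha hb
  have h3 : y ≤ a * y := le_mul_of_one_le_left hy ha
  have h4 : x ≤ x * b := le_mul_of_one_le_right hx hb
  have hx0 : x = 0 := by omega
  have hy0 : y = 0 := by omega
  rw [hx0, hy0, mul_zero, zero_mul, add_zero, add_zero] at h1
  rcases Int.eq_one_or_neg_one_of_mul_eq_one' h1 with h | h <;> omega

/-! ### Complete smooth fans and generators that can be removed -/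

/-- A complete smooth fan in the plane: the finite set `U` of its primitive ray generators,
together with the map `s` that sends each of them to the next one in counterclockwise order. -/
structure IsSmoothFan (U : Finset (ℤ × ℤ)) (s : ℤ × ℤ → ℤ × ℤ) : Prop where
  mapsTo : ∀ u ∈ U, s u ∈ U
  ldet_eq : ∀ u ∈ U, ldet u (s u) = 1
  not_between : ∀ u ∈ U, ∀ v ∈ U, 0 < ldet u v → ¬ 0 < ldet v (s u)
  complete : ∀ x : ℤ × ℤ, ∃ u ∈ U, 0 ≤ ldet u x ∧ 0 ≤ ldet x (s u)

namespace IsSmoothFan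

variable {U : Finset (ℤ × ℤ)} {s : ℤ × ℤ → ℤ × ℤ}

/-- If v came strictly after u, it would lie strictly between u and the common successor. By
symmetry u and v are parallel, and the common successor is on the same side of both. -/
lemma injOn (hU : IsSmoothFan U s) : ∀ u ∈ U, ∀ v ∈ U, s u = s v → u = v := by
  have key : ∀ u ∈ U, ∀ v ∈ U, s u = s v → ldet u v ≤ 0 := by
    intro u hu v hv h
    by_contra hc
    refine hU.not_between u hu v hv (by omega) ?_
    rw [h, hU.ldet_eq v hv]; exact one_pos
  intro u hu v hv h
  have h1 := key u hu v hv h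
  have h2 := key v hv u hu h.symm
  rw [ldet_swap] at h2
  exact (eq_of_ldet_eq_zero (hU.ldet_eq u hu) (hU.ldet_eq v hv) (by omega)
    (by rw [h, hU.ldet_eq v hv]; exact one_pos)).symm

lemma surjOn (hU : IsSmoothFan U s) : ∀ v ∈ U, ∃ u ∈ U, s u = v := by
  intro v hv
  obtain ⟨u, hu, h⟩ := Finset.surj_on_of_inj_on_of_card_le (s := U) (t := U)
    (fun u _ => s u) (fun u hu => hU.mapsTo u hu) (fun u v hu hv h => hU.injOn u hu v hv h)
    le_rfl v hv
  exact ⟨u, hu, h.symm⟩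

lemma succ_ne (hU : IsSmoothFan U s) {u : ℤ × ℤ} (hu : u ∈ U) : s u ≠ u := by
  intro h
  have := hU.ldet_eq u hu
  rw [h, ldet_self] at this; omega

lemma succ_succ_ne (hU : IsSmoothFan U s) {u : ℤ × ℤ} (hu : u ∈ U) : s (s u) ≠ u := by
  intro h
  have h1 := hU.ldet_eq u hu
  have h2 := hU.ldet_eq _ (hU.mapsTo u hu)
  rw [h, ldet_swap] at h2; omega

/-- Neighbours of a ray generator add up to a multiple of it. -/
lemma add_succ_succ (hU : IsSmoothFan U s) {u : ℤ × ℤ} (hu : u ∈ U) :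
    u + s (s u) = ldet u (s (s u)) • s u := by
  have h1 := hU.ldet_eq u hu
  have h2 := hU.ldet_eq _ (hU.mapsTo u hu)
  refine ext_ldet h1 ?_ ?_
  · simp only [ldet, Prod.fst_add, Prod.snd_add, Prod.smul_fst, Prod.smul_snd, smul_eq_mul] at *
    linear_combination (-u.1 * (s (s u)).2 + u.2 * (s (s u)).1) * h1
  · simp only [ldet, Prod.fst_add, Prod.snd_add, Prod.smul_fst, Prod.smul_snd, smul_eq_mul] at *
    linear_combination h1 - h2

/-- A ray generator in the closed cone between two neighbours is one of them. -/
lemma eq_or_eq (hU : IsSmoothFan U s) {u v : ℤ × ℤ} (hu : u ∈ U) (hv : v ∈ U)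
    (h₁ : 0 ≤ ldet u v) (h₂ : 0 ≤ ldet v (s u)) : v = u ∨ v = s u := by
  have hus := hU.ldet_eq u hu
  have hvs := hU.ldet_eq v hv
  have hx := eq_of_ldet_eq_one hus v
  have hne : ¬ (ldet u v = 0 ∧ ldet v (s u) = 0) := by
    rintro ⟨h3, h4⟩
    rw [h3, h4] at hx
    rw [hx] at hvs; simp [ldet] at hvs
  have := hU.not_between u hu v hv
  rcases h₁.eq_or_lt with h | h
  · left
    exact eq_of_ldet_eq_zero hus hvs h.symm (by omega)
  · right
    have h0 : ldet v (s u) = 0 := by omega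
    refine eq_of_ldet_eq_zero (u' := -u) (v' := s v) ?_ hvs ?_ ?_
    · rw [ldet_neg_right, ldet_swap]; omega
    · rw [ldet_swap]; omega
    · rw [ldet_neg_right, ldet_swap]; omega

lemma nonempty (hU : IsSmoothFan U s) : U.Nonempty := by
  obtain ⟨u, hu, -⟩ := hU.complete 0
  exact ⟨u, hu⟩

lemma three_le_card (hU : IsSmoothFan U s) : 3 ≤ U.card := by
  obtain ⟨u, hu⟩ := hU.nonempty
  have hsu := hU.mapsTo u hu
  have hssu := hU.mapsTo _ hsu
  have h : ({u, s u, s (s u)} : Finset (ℤ × ℤ)).card = 3 :=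
    Finset.card_eq_three.2 ⟨u, s u, s (s u), (hU.succ_ne hu).symm, (hU.succ_succ_ne hu).symm,
      (hU.succ_ne hsu).symm, rfl⟩
  rw [← h]
  apply Finset.card_le_card
  intro x hx
  simp only [Finset.mem_insert, Finset.mem_singleton] at hx
  rcases hx with rfl | rfl | rfl <;> assumption

/-- A fan that contains `-r` does not jump over it: the successor of a generator of positive height
over `r` has height `≥ 0`. -/
lemma ldet_succ_nonneg (hU : IsSmoothFan U s) {r u : ℤ × ℤ} (hr' : -r ∈ U)
    (hu : u ∈ U) (h : 0 < ldet r u) : 0 ≤ ldet r (s u) := by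
  by_contra hc
  refine hU.not_between u hu (-r) hr' ?_ ?_
  · rw [ldet_neg_right, ldet_swap]; omega
  · rw [ldet_neg_left]; omega

/-- Otherwise r would lie strictly between u and its successor. -/
lemma ldet_nonneg_of_succ (hU : IsSmoothFan U s) {r u : ℤ × ℤ} (hr : r ∈ U)
    (hu : u ∈ U) (h : 0 < ldet r (s u)) : 0 ≤ ldet r u := by
  by_contra hc
  refine hU.not_between u hu r hr ?_ h
  rw [ldet_swap]; omega

/-- Height zero makes u an integer multiple of r, and the multiplier divides `ldet u (s u) = 1`. -/
lemma eq_or_eq_neg (hU : IsSmoothFan U s) {r u : ℤ × ℤ} (hr : r ∈ U)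
    (hu : u ∈ U) (h : ldet r u = 0) : u = r ∨ u = -r := by
  have hrs := hU.ldet_eq r hr
  have hx := eq_of_ldet_eq_one hrs u
  rw [h] at hx
  have hk : ldet u (s r) * ldet r (s u) = 1 := by
    have hw : ∀ w, ldet u w = ldet u (s r) * ldet r w := by
      intro w
      simp only [ldet] at *
      linear_combination (-(u.1 * w.2 - u.2 * w.1)) * hrs +
        ((s r).1 * w.2 - (s r).2 * w.1) * h
    rw [← hw, hU.ldet_eq u hu]
  rcases Int.eq_one_or_neg_one_of_mul_eq_one hk with h | h
  · left; rw [hx, h]; ext <;> simp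
  · right; rw [hx, h]; ext <;> simp

/-- If two opposite generators are separated by at least two others, some generator is the sum of
its neighbours. -/
lemma exists_blowdown_of_upper (hU : IsSmoothFan U s) {r : ℤ × ℤ} (hr : r ∈ U) (hr' : -r ∈ U)
    (hcard : 2 ≤ (U.filter (fun u => 0 < ldet r u)).card) :
    ∃ u ∈ U, u + s (s u) = s u := by
  set W := U.filter (fun u => 0 < ldet r u) with hW
  have hWne : W.Nonempty := Finset.card_pos.1 (by omega)
  -- A generator of maximal height over r is chosen, and among those of this height the one farthest
  -- in the direction of r. Comparing heights in p + q = a m then leaves a = 0, 1, 2.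
  obtain ⟨m₀, hm₀, hmax₀⟩ := W.exists_max_image (ldet r) hWne
  have hne : (W.filter (fun u => ldet r u = ldet r m₀)).Nonempty := ⟨m₀, by simp [hm₀]⟩
  obtain ⟨m, hm, hmax⟩ := (W.filter (fun u => ldet r u = ldet r m₀)).exists_max_image
    (fun u => r.1 * u.1 + r.2 * u.2) hne
  simp only [Finset.mem_filter, hW, and_imp] at hm hmax hmax₀ hm₀
  obtain ⟨⟨hmU, hmpos⟩, hmeq⟩ := hm
  obtain ⟨p, hp, rfl⟩ := hU.surjOn m hmU
  refine ⟨p, hp, ?_⟩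
  have hq := hU.mapsTo _ hmU
  have hsum := hU.add_succ_succ hp
  set a := ldet p (s (s p)) with ha
  have hhp : 0 ≤ ldet r p := hU.ldet_nonneg_of_succ hr hp hmpos
  have hhq : 0 ≤ ldet r (s (s p)) := hU.ldet_succ_nonneg hr' hmU hmpos
  have hpm : ldet r p ≤ ldet r (s p) := by
    rcases hhp.eq_or_lt with h | h
    · omega
    · rw [hmeq]; exact hmax₀ p hp h
  have hqm : ldet r (s (s p)) ≤ ldet r (s p) := by
    rcases hhq.eq_or_lt with h | h
    · omega
    · rw [hmeq]; exact hmax₀ _ hq h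
  have hheights : ldet r p + ldet r (s (s p)) = a * ldet r (s p) := by
    rw [← ldet_add_right, hsum]
    simp only [ldet, Prod.smul_fst, Prod.smul_snd, smul_eq_mul]; ring
  have ha0 : 0 ≤ a := by by_contra hc; nlinarith
  have ha2 : a ≤ 2 := by by_contra hc; nlinarith
  have hcases : a = 0 ∨ a = 1 ∨ a = 2 := by omega
  rcases hcases with h | h | h
  -- a = 0: both neighbours have height zero, so they are r and -r, and the chosen generator is the
  -- only one above r.
  · exfalso
    rw [h] at hheights
    have hp0 : ldet r p = 0 := by omega
    have hq0 : ldet r (s (s p)) = 0 := by omega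
    have hpr : p = r := by
      rcases hU.eq_or_eq_neg hr hp hp0 with h1 | h1
      · exact h1
      · have := hU.ldet_eq p hp
        rw [h1, ldet_neg_left, ← h1] at this; omega
    have hqr : s (s p) = -r := by
      rw [h, zero_smul] at hsum
      rw [← hpr]; exact eq_neg_of_add_eq_zero_right hsum
    have hsub : U.filter (fun u => 0 < ldet r u) ⊆ {s p} := by
      intro u hu
      rw [Finset.mem_filter] at hu
      obtain ⟨huU, hu0⟩ := hu
      rw [Finset.mem_singleton]
      rcases le_total 0 (ldet u (s p)) with h1 | h1
      · rcases hU.eq_or_eq hp huU (by rw [hpr]; exact hu0.le) h1 with h2 | h2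
        · rw [h2, hpr, ldet_self] at hu0; omega
        · exact h2
      · rcases hU.eq_or_eq hmU huU (by rw [ldet_swap]; omega)
          (by rw [hqr, ldet_neg_right, ldet_swap]; omega) with h2 | h2
        · exact h2
        · rw [h2, hqr, ldet_neg_right, ldet_self] at hu0; omega
    have := Finset.card_le_card hsub
    rw [Finset.card_singleton] at this
    rw [hW] at hcard
    omega
  · rw [hsum, h, one_smul]
  -- a = 2: the chosen generator is the midpoint of two neighbours of the same height, and the
  -- tie-break makes all three coincide.
  · exfalso
    rw [h] at hheights
    have hpe : ldet r p = ldet r (s p) := by omega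
    have hqe : ldet r (s (s p)) = ldet r (s p) := by omega
    have h1 := hmax p hp (by omega) (by omega)
    have h2 := hmax _ hq (by omega) (by omega)
    have hs1 := congrArg Prod.fst hsum
    have hs2 := congrArg Prod.snd hsum
    rw [h] at hs1 hs2
    simp only [Prod.fst_add, Prod.snd_add, Prod.smul_fst, Prod.smul_snd, smul_eq_mul] at hs1 hs2
    have hdot : r.1 * p.1 + r.2 * p.2 = r.1 * (s p).1 + r.2 * (s p).2 := by
      have h3 : r.1 * (s (s p)).1 + r.2 * (s (s p)).2 =
          2 * (r.1 * (s p).1 + r.2 * (s p).2) - (r.1 * p.1 + r.2 * p.2) := by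
        linear_combination r.1 * hs1 + r.2 * hs2
      omega
    have hrs := hU.ldet_eq r hr
    have hrr : 0 < r.1 ^ 2 + r.2 ^ 2 := by
      by_contra hc
      have h1 : r.1 = 0 := by nlinarith
      have h2 : r.2 = 0 := by nlinarith
      simp [ldet, h1, h2] at hrs
    simp only [ldet] at hpe
    have e1 : (r.1 ^ 2 + r.2 ^ 2) * (p.1 - (s p).1) = 0 := by
      linear_combination r.1 * hdot - r.2 * hpe
    have e2 : (r.1 ^ 2 + r.2 ^ 2) * (p.2 - (s p).2) = 0 := by
      linear_combination r.2 * hdot + r.1 * hpe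
    have f1 := (mul_eq_zero.1 e1).resolve_left hrr.ne'
    have f2 := (mul_eq_zero.1 e2).resolve_left hrr.ne'
    exact hU.succ_ne hp (by ext <;> omega)

/-- Three consecutive generators with sum zero that form a cycle are the whole fan. -/
lemma subset_of_cycle (hU : IsSmoothFan U s) {p : ℤ × ℤ} (hp : p ∈ U)
    (hsum : p + s (s p) = -s p) (hcyc : s (s (s p)) = p) : U ⊆ {p, s p, s (s p)} := by
  intro x hx
  simp only [Finset.mem_insert, Finset.mem_singleton]
  have hm := hU.mapsTo p hp
  -- The three generators sum to zero, hence so do the determinants of x with them; their signs then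
  -- place x in one of the three closed cones.
  have c : ldet x p + ldet x (s p) + ldet x (s (s p)) = 0 := by
    have : p = -s p + -s (s p) := by
      rw [← hsum, add_neg_cancel_right]
    conv_lhs => rw [this]
    rw [ldet_add_right, ldet_neg_right, ldet_neg_right, ← this]; ring
  have d1 := ldet_swap x p
  have d2 := ldet_swap x (s p)
  have d3 := ldet_swap x (s (s p))
  have t1 := hU.eq_or_eq hp hx
  have t2 := hU.eq_or_eq hm hx
  have t3 := hU.eq_or_eq (hU.mapsTo _ hm) hx
  rw [hcyc] at t3
  by_contra! hc
  obtain ⟨hc1, hc2, hc3⟩ := hc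
  have t1' : 0 ≤ ldet p x → ¬ 0 ≤ ldet x (s p) := fun h h' => by have := t1 h h'; tauto
  have t2' : 0 ≤ ldet (s p) x → ¬ 0 ≤ ldet x (s (s p)) := fun h h' => by have := t2 h h'; tauto
  have t3' : 0 ≤ ldet (s (s p)) x → ¬ 0 ≤ ldet x p := fun h h' => by have := t3 h h'; tauto
  clear t1 t2 t3
  omega

/-- A fan with at least four rays has two opposite generators, or a generator that is the sum of its
neighbours. -/
lemma exists_opposite_or_blowdown (hU : IsSmoothFan U s) (hcard : 4 ≤ U.card) :
    (∃ r ∈ U, -r ∈ U) ∨ ∃ u ∈ U, u + s (s u) = s u := by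
  obtain ⟨m, hm, hmax⟩ := U.exists_max_image (fun u => u.1 ^ 2 + u.2 ^ 2) hU.nonempty
  obtain ⟨p, hp, rfl⟩ := hU.surjOn m hm
  have hq := hU.mapsTo _ hm
  have hsum := hU.add_succ_succ hp
  have hpm := hU.ldet_eq p hp
  have hmq := hU.ldet_eq _ hm
  have h1 := hmax p hp
  have h2 := hmax _ hq
  set a := ldet p (s (s p)) with ha
  set m := s p with hmdef
  set q := s m with hqdef
  have hs1 := congrArg Prod.fst hsum
  have hs2 := congrArg Prod.snd hsum
  simp only [Prod.fst_add, Prod.snd_add, Prod.smul_fst, Prod.smul_snd, smul_eq_mul] at hs1 hs2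
  -- Parallelogram law for p + q = a m. As m has maximal norm and p ≠ q, it forces a ^ 2 < 4.
  have hpar : a ^ 2 * (m.1 ^ 2 + m.2 ^ 2) + ((p.1 - q.1) ^ 2 + (p.2 - q.2) ^ 2) =
      2 * (p.1 ^ 2 + p.2 ^ 2) + 2 * (q.1 ^ 2 + q.2 ^ 2) := by
    linear_combination (-(p.1 + q.1) - a * m.1) * hs1 + (-(p.2 + q.2) - a * m.2) * hs2
  have hmm : 0 < m.1 ^ 2 + m.2 ^ 2 := by
    by_contra hc
    have h1 : m.1 = 0 := by nlinarith
    have h2 : m.2 = 0 := by nlinarith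
    simp [ldet, h1, h2] at hpm
  have hpq : 0 < (p.1 - q.1) ^ 2 + (p.2 - q.2) ^ 2 := by
    by_contra hc
    have h1 : p.1 - q.1 = 0 := by nlinarith
    have h2 : p.2 - q.2 = 0 := by nlinarith
    exact hU.succ_succ_ne hp
      (Prod.ext (show q.1 = p.1 by omega) (show q.2 = p.2 by omega))
  have ha4 : a ^ 2 < 4 := by
    by_contra hc
    nlinarith
  have hal : -2 < a := by nlinarith
  have hau : a < 2 := by nlinarith
  have hcases : a = 0 ∨ a = 1 ∨ a = -1 := by omega
  rcases hcases with h | h | h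
  · left
    rw [h, zero_smul] at hsum
    exact ⟨p, hp, by rwa [neg_eq_of_add_eq_zero_right hsum]⟩
  · right
    exact ⟨p, hp, by rw [hsum, h, one_smul]⟩
  · left
    refine ⟨m, hm, ?_⟩
    rw [h, neg_one_smul] at hsum
    -- Here p, m, q sum to zero. If -m is not a generator, it is interior to a cone of the fan
    -- spanned by u and `s u`, which lies inside the unimodular cone spanned by q and p. Expanding
    -- the determinant of the inner cone (`e3`) forces the two cones to agree, so the fan has only
    -- three rays.
    obtain ⟨u, hu, hu1, hu2⟩ := hU.complete (-m)
    have hsu := hU.mapsTo u hu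
    have hus := hU.ldet_eq u hu
    rw [ldet_neg_right, ldet_swap, neg_neg] at hu1
    rw [ldet_neg_left, ldet_swap, neg_neg] at hu2
    rcases hu1.eq_or_lt with h0 | h0
    · rcases hU.eq_or_eq_neg hm hu h0.symm with h3 | h3
      · rw [h3, hmq] at hus
        rw [h3, ldet_swap, hmq] at hu2; omega
      · rwa [← h3]
    rcases hu2.eq_or_lt with h0' | h0'
    · rcases hU.eq_or_eq_neg hm hsu (by rw [ldet_swap]; omega) with h3 | h3
      · rw [h3, ldet_swap] at hus; omega
      · rwa [← h3]
    exfalso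
    have hqu : 0 ≤ ldet q u := by
      have := hU.not_between m hm u hu h0
      rw [← hqdef] at this
      rw [ldet_swap]; omega
    have hpu : 0 ≤ ldet (s u) p := by
      by_contra hc
      exact hU.not_between p hp _ hsu (by rw [ldet_swap]; omega) h0'
    have hqp : ldet q p = 1 := by
      have : p = -m + -q := by
        rw [← hsum, add_neg_cancel_right]
      rw [this, ldet_add_right, ldet_neg_right, ldet_neg_right, ldet_self, ldet_swap]; omega
    have e1 : ldet u p = ldet m u + ldet q u := by
      have : p = -m + -q := by
        rw [← hsum, add_neg_cancel_right]
      rw [this, ldet_add_right, ldet_neg_right, ldet_neg_right, ldet_swap u m, ldet_swap u q]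
    have e2 : ldet q (s u) = ldet (s u) m + ldet (s u) p := by
      have : q = -m + -p := by
        rw [← hsum]; abel
      rw [this, ldet_add_left, ldet_neg_left, ldet_neg_left, ldet_swap (s u) m,
        ldet_swap (s u) p]
      ring
    have e3 : ldet u p * ldet q (s u) - ldet q u * ldet (s u) p = 1 := by
      rw [← hus, ← one_mul (ldet u (s u)), ← hqp]; simp only [ldet]; ring
    rw [e1, e2] at e3
    obtain ⟨hqu0, hpu0, hmu, hum⟩ := eq_of_mul_sub_mul_eq_one h0 h0' hqu hpu e3
    have hup : ldet u p = 1 := by omega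
    have huq : u = q := ext_ldet hqp (by rw [hqu0, ldet_self]) (by rw [hup, hqp])
    have hsq : s q = p := by
      rw [← huq]
      refine ext_ldet hqp ?_ ?_
      · rw [e2, hqp]; omega
      · rw [hpu0, ldet_self]
    have := (Finset.card_le_card (hU.subset_of_cycle hp hsum hsq)).trans Finset.card_le_three
    omega

/-- In a fan with at least five rays some generator is the sum of its neighbours. -/
lemma exists_blowdown (hU : IsSmoothFan U s) (hcard : 5 ≤ U.card) :
    ∃ u ∈ U, u + s (s u) = s u := by
  rcases hU.exists_opposite_or_blowdown (by omega) with ⟨r, hr, hr'⟩ | h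
  swap
  · exact h
  -- Apart from r and -r every generator is strictly on one side of the line through r, so with five
  -- generators one side contains at least two.
  have hsub : U ⊆ {r, -r} ∪ (U.filter (fun u => 0 < ldet r u) ∪
      U.filter (fun u => 0 < ldet (-r) u)) := by
    intro u hu
    simp only [Finset.mem_union, Finset.mem_insert, Finset.mem_singleton, Finset.mem_filter,
      ldet_neg_left]
    rcases lt_trichotomy (ldet r u) 0 with h | h | h
    · exact Or.inr (Or.inr ⟨hu, by omega⟩)
    · exact Or.inl (hU.eq_or_eq_neg hr hu h)
    · exact Or.inr (Or.inl ⟨hu, h⟩)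
  have h1 := (Finset.card_le_card hsub).trans (Finset.card_union_le _ _)
  have h2 := Finset.card_union_le (U.filter (fun u => 0 < ldet r u))
    (U.filter (fun u => 0 < ldet (-r) u))
  have h3 : ({r, -r} : Finset (ℤ × ℤ)).card ≤ 2 := Finset.card_le_two
  rcases le_or_gt 2 (U.filter (fun u => 0 < ldet r u)).card with h | h
  · exact hU.exists_blowdown_of_upper hr hr' h
  · exact hU.exists_blowdown_of_upper hr' (by rwa [neg_neg]) (by omega)

end IsSmoothFan

/-! ### Support numbers, blow-downs and enclosing parallelograms -/

/-- The pairing of an integral functional with a point of the plane. -/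
def latticePairing (u : ℤ × ℤ) (x : Fin 2 → ℝ) : ℝ := u.1 * x 0 + u.2 * x 1

lemma latticePairing_add_left (u v : ℤ × ℤ) (x : Fin 2 → ℝ) :
    latticePairing (u + v) x = latticePairing u x + latticePairing v x := by
  simp only [latticePairing, Prod.fst_add, Prod.snd_add]; push_cast; ring

lemma latticePairing_neg_left (u : ℤ × ℤ) (x : Fin 2 → ℝ) :
    latticePairing (-u) x = -latticePairing u x := by
  simp only [latticePairing, Prod.fst_neg, Prod.snd_neg]; push_cast; ring

lemma latticePairing_smul_left (k : ℤ) (u : ℤ × ℤ) (x : Fin 2 → ℝ) :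
    latticePairing (k • u) x = k * latticePairing u x := by
  simp only [latticePairing, Prod.smul_fst, Prod.smul_snd, smul_eq_mul]; push_cast; ring

/-- The polyhedron with inner normals in `U` and support numbers `h`. -/
def supportRegion (U : Finset (ℤ × ℤ)) (h : ℤ × ℤ → ℤ) : Set (Fin 2 → ℝ) :=
  {x | ∀ u ∈ U, (h u : ℝ) ≤ latticePairing u x}

/-- The lattice parallelogram with inner normals `±r`, `±t` and side lengths `A`, `B`. -/
def latticeBox (r t : ℤ × ℤ) (c d A B : ℤ) : Set (Fin 2 → ℝ) :=
  {x | c ≤ latticePairing r x ∧ latticePairing r x ≤ c + A ∧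
    d ≤ latticePairing t x ∧ latticePairing t x ≤ d + B}

/-- The lattice length, in terms of support numbers, of the edge whose inner normal is the successor
of `u`. -/
def edgeLen (s : ℤ × ℤ → ℤ × ℤ) (h : ℤ × ℤ → ℤ) (u : ℤ × ℤ) : ℤ :=
  ldet u (s (s u)) * h (s u) - h u - h (s (s u))

namespace IsSmoothFan

variable {U : Finset (ℤ × ℤ)} {s : ℤ × ℤ → ℤ × ℤ}

/-- Removing a generator that is the sum of its neighbours leaves a smooth fan. -/
lemma blowdown (hU : IsSmoothFan U s) {p : ℤ × ℤ} (hp : p ∈ U) (hsum : p + s (s p) = s p) :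
    IsSmoothFan (U.erase (s p)) (Function.update s p (s (s p))) := by
  have hm := hU.mapsTo p hp
  have hq := hU.mapsTo _ hm
  have hpm := hU.ldet_eq p hp
  have hmq := hU.ldet_eq _ hm
  have hpq : ldet p (s (s p)) = 1 := by
    rw [← hpm]; conv_rhs => rw [← hsum]
    rw [ldet_add_right, ldet_self, zero_add]
  have cm : ∀ x, ldet x (s p) = ldet x p + ldet x (s (s p)) := fun x => by
    rw [← ldet_add_right, hsum]
  refine ⟨?_, ?_, ?_, ?_⟩
  · intro u hu
    obtain ⟨hne, hu⟩ := Finset.mem_erase.1 hu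
    by_cases h : u = p
    · subst h
      rw [Function.update_self]
      exact Finset.mem_erase.2 ⟨hU.succ_ne hm, hq⟩
    · rw [Function.update_of_ne h]
      exact Finset.mem_erase.2 ⟨fun h' => h (hU.injOn u hu p hp h'), hU.mapsTo u hu⟩
  · intro u hu
    obtain ⟨hne, hu⟩ := Finset.mem_erase.1 hu
    by_cases h : u = p
    · subst h
      rw [Function.update_self, hpq]
    · rw [Function.update_of_ne h]
      exact hU.ldet_eq u hu
  · intro u hu v hv h1 h2
    obtain ⟨hne, hu⟩ := Finset.mem_erase.1 hu
    obtain ⟨hvne, hvU⟩ := Finset.mem_erase.1 hv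
    by_cases h : u = p
    · subst h
      rw [Function.update_self] at h2
      rcases le_total 0 (ldet v (s u)) with h3 | h3
      · rcases hU.eq_or_eq hp hvU h1.le h3 with h4 | h4
        · rw [h4, ldet_self] at h1; omega
        · exact hvne h4
      · rcases hU.eq_or_eq hm hvU (by rw [ldet_swap]; omega) h2.le with h4 | h4
        · exact hvne h4
        · rw [h4, ldet_self] at h2; omega
    · rw [Function.update_of_ne h] at h2
      exact hU.not_between u hu v hvU h1 h2
  · intro x
    obtain ⟨u, hu, h1, h2⟩ := hU.complete x
    have hcm := cm x
    have hpmem : p ∈ U.erase (s p) := Finset.mem_erase.2 ⟨(hU.succ_ne hp).symm, hp⟩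
    by_cases h : u = p
    · subst h
      refine ⟨u, hpmem, h1, ?_⟩
      rw [Function.update_self]
      rw [ldet_swap] at h1; omega
    by_cases h' : u = s p
    · subst h'
      refine ⟨p, hpmem, ?_, ?_⟩
      · rw [ldet_swap] at h1 ⊢; omega
      · rw [Function.update_self]; exact h2
    · refine ⟨u, Finset.mem_erase.2 ⟨h', hu⟩, h1, ?_⟩
      rwa [Function.update_of_ne h]

/-- `edgeLen` is indexed by the predecessor of the normal, so the excluded indices are those of the
edges with normals p and `s (s p)`, the neighbours of the removed edge. -/
lemma edgeLen_blowdown_of_ne {p u : ℤ × ℤ} (h : ℤ × ℤ → ℤ) (h₁ : u ≠ p) (h₂ : s u ≠ p) :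
    edgeLen (Function.update s p (s (s p))) h u = edgeLen s h u := by
  simp only [edgeLen, Function.update_of_ne h₁, Function.update_of_ne h₂]

/-- Prolonging the neighbours of the removed edge adds a multiple of a unimodular triangle. All
three of its sides have the length `edgeLen s h p` of that edge. -/
lemma edgeLen_blowdown_self (hU : IsSmoothFan U s) {p : ℤ × ℤ} (hp : p ∈ U)
    (hsum : p + s (s p) = s p) (h : ℤ × ℤ → ℤ) :
    edgeLen (Function.update s p (s (s p))) h p = edgeLen s h (s p) + edgeLen s h p := by
  have hq := hU.mapsTo _ (hU.mapsTo p hp)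
  have h1 := hU.ldet_eq _ hq
  have h2 : ldet p (s (s p)) = 1 := by
    rw [← hU.ldet_eq p hp]; conv_rhs => rw [← hsum]
    rw [ldet_add_right, ldet_self, zero_add]
  have h3 : ldet (s p) (s (s (s p))) = ldet p (s (s (s p))) + 1 := by
    rw [← h1, ← ldet_add_left, hsum]
  simp only [edgeLen, Function.update_self, Function.update_of_ne (hU.succ_succ_ne hp), h2, h3]
  ring

lemma edgeLen_blowdown_pred (hU : IsSmoothFan U s) {p u : ℤ × ℤ} (hu : u ∈ U)
    (hup : s u = p) (hsum : p + s (s p) = s p) (h : ℤ × ℤ → ℤ) :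
    edgeLen (Function.update s p (s (s p))) h u = edgeLen s h u + edgeLen s h p := by
  have hp : p ∈ U := hup ▸ hU.mapsTo u hu
  have hne : u ≠ p := fun h => hU.succ_ne hu (hup.trans h.symm)
  have h1 := hU.ldet_eq _ hu
  have h2 : ldet p (s (s p)) = 1 := by
    rw [← hU.ldet_eq p hp]; conv_rhs => rw [← hsum]
    rw [ldet_add_right, ldet_self, zero_add]
  have h3 : ldet u (s p) = 1 + ldet u (s (s p)) := by
    rw [← h1, hup, ← ldet_add_right, hsum]
  simp only [edgeLen, Function.update_of_ne hne, hup, Function.update_self, h2, h3]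
  ring

/-- Each edge grows by at most the length of the one removed edge: the source of every factor 2
below. -/
lemma edgeLen_blowdown_mem (hU : IsSmoothFan U s) {p : ℤ × ℤ} (hp : p ∈ U)
    (hsum : p + s (s p) = s p) {h : ℤ × ℤ → ℤ} {b : ℤ}
    (hlen : ∀ u ∈ U, 1 ≤ edgeLen s h u ∧ edgeLen s h u ≤ b) :
    ∀ u ∈ U.erase (s p), 1 ≤ edgeLen (Function.update s p (s (s p))) h u ∧
      edgeLen (Function.update s p (s (s p))) h u ≤ 2 * b := by
  intro u hu
  have hu := Finset.mem_of_mem_erase hu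
  have l1 := hlen p hp
  by_cases h1 : u = p
  · have l2 := hlen _ (hU.mapsTo p hp)
    rw [h1, hU.edgeLen_blowdown_self hp hsum]; omega
  have l2 := hlen u hu
  by_cases h2 : s u = p
  · rw [hU.edgeLen_blowdown_pred hu h2 hsum]; omega
  · rw [edgeLen_blowdown_of_ne h h1 h2]; omega

lemma supportRegion_subset_erase (h : ℤ × ℤ → ℤ) (m : ℤ × ℤ) :
    supportRegion U h ⊆ supportRegion (U.erase m) h :=
  fun _ hx u hu => hx u (Finset.mem_of_mem_erase hu)

/-- If `s (s r)` were still strictly above r, then r, -r, the successor of -r below, and two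
generators above would be five. -/
lemma succ_succ_eq_neg (hU : IsSmoothFan U s) (hcard : U.card ≤ 4) {r : ℤ × ℤ} (hr : r ∈ U)
    (hr' : -r ∈ U) : s (s r) = -r := by
  have h1 := hU.mapsTo r hr
  have h2 := hU.mapsTo _ h1
  have h3 := hU.mapsTo _ hr'
  have c1 := hU.ldet_eq r hr
  have c3 := hU.ldet_eq _ hr'
  rw [ldet_neg_left] at c3
  have c0 := ldet_self r
  have c0' := ldet_neg_right r r
  have c2 := hU.ldet_succ_nonneg hr' h1 (by omega)
  by_contra hne
  have hpos : 0 < ldet r (s (s r)) := by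
    rcases c2.eq_or_lt with h | h
    · rcases hU.eq_or_eq_neg hr h2 h.symm with h' | h'
      · exact absurd h' (hU.succ_succ_ne hr)
      · exact absurd h' hne
    · exact h
  have hrr : r ≠ -r := by
    intro h; rw [← h] at c3; omega
  have hsub : ({r, -r, s (-r), s r, s (s r)} : Finset (ℤ × ℤ)) ⊆ U := by
    intro x hx
    simp only [Finset.mem_insert, Finset.mem_singleton] at hx
    rcases hx with rfl | rfl | rfl | rfl | rfl <;> assumption
  have hle := Finset.card_le_card hsub
  have n1 : s (-r) ≠ s r := fun h => by rw [h] at c3; omega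
  have n2 : s (-r) ≠ s (s r) := fun h => by rw [h] at c3; omega
  have n3 : r ≠ s (-r) := fun h => by rw [← h] at c3; omega
  have n4 : r ≠ s (s r) := fun h => hU.succ_succ_ne hr h.symm
  have n5 : -r ≠ s r := fun h => by rw [← h] at c1; omega
  have n6 : -r ≠ s (s r) := fun h => hne h.symm
  rw [Finset.card_insert_of_notMem, Finset.card_insert_of_notMem, Finset.card_insert_of_notMem,
    Finset.card_insert_of_notMem, Finset.card_singleton] at hle
  · omega
  · simpa using (hU.succ_ne h1).symm
  · simp only [Finset.mem_insert, Finset.mem_singleton, not_or]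
    exact ⟨n1, n2⟩
  · simp only [Finset.mem_insert, Finset.mem_singleton, not_or]
    exact ⟨(hU.succ_ne hr').symm, n5, n6⟩
  · simp only [Finset.mem_insert, Finset.mem_singleton, not_or]
    exact ⟨hrr, n3, (hU.succ_ne hr).symm, n4⟩

/-- A fan with four rays has two opposite generators. -/
lemma exists_opposite_of_card_eq_four (hU : IsSmoothFan U s) (hcard : U.card = 4) :
    ∃ r ∈ U, -r ∈ U := by
  rcases hU.exists_opposite_or_blowdown hcard.ge with h | ⟨p, hp, hsum⟩
  · exact h
  have hm := hU.mapsTo p hp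
  have hq := hU.mapsTo _ hm
  have hz := hU.mapsTo _ hq
  have hsz := hU.mapsTo _ hz
  have c1 := hU.ldet_eq p hp
  have c3 := hU.ldet_eq _ hq
  have c4 := hU.ldet_eq _ hz
  have c2 : ldet p (s (s p)) = 1 := by
    rw [← c1]; conv_rhs => rw [← hsum]
    rw [ldet_add_right, ldet_self, zero_add]
  have hzp : s (s (s p)) ≠ p := by
    intro h; rw [h, ldet_swap] at c3; omega
  have hzm : s (s (s p)) ≠ s p := hU.succ_succ_ne hm
  have hzq : s (s (s p)) ≠ s (s p) := hU.succ_ne hq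
  have hmq : s (s p) ≠ s p := hU.succ_ne hm
  have hpm : s p ≠ p := hU.succ_ne hp
  have hpq : s (s p) ≠ p := hU.succ_succ_ne hp
  have hset : ({p, s p, s (s p), s (s (s p))} : Finset (ℤ × ℤ)) = U := by
    apply Finset.eq_of_subset_of_card_le
    · intro x hx
      simp only [Finset.mem_insert, Finset.mem_singleton] at hx
      rcases hx with rfl | rfl | rfl | rfl <;> assumption
    · rw [hcard, Finset.card_insert_of_notMem, Finset.card_insert_of_notMem,
        Finset.card_insert_of_notMem, Finset.card_singleton]
      · simpa using hzq.symm
      · simp only [Finset.mem_insert, Finset.mem_singleton, not_or]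
        exact ⟨hmq.symm, hzm.symm⟩
      · simp only [Finset.mem_insert, Finset.mem_singleton, not_or]
        exact ⟨hpm.symm, hpq.symm, hzp.symm⟩
  have hszp : s (s (s (s p))) = p := by
    rw [← hset] at hsz
    simp only [Finset.mem_insert, Finset.mem_singleton] at hsz
    rcases hsz with h | h | h | h
    · exact h
    · exact absurd (hU.injOn _ hz p hp h) hzp
    · exact absurd (hU.injOn _ hz _ hm h) hzm
    · exact absurd h (hU.succ_ne hz)
  rw [hszp] at c4
  -- The fourth generator closes the cycle, so its determinants with the basis p, `s (s p)` are
  -- known; they are those of `-s p`.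
  refine ⟨s p, hm, ?_⟩
  have : s (s (s p)) = -s p := by
    refine ext_ldet c2 ?_ ?_
    · rw [ldet_neg_right, c1, ldet_swap, c4]
    · rw [ldet_neg_left, hU.ldet_eq _ hm, ldet_swap, c3]
  rwa [← this]

/-- For a fan with four rays, the region lies in a lattice parallelogram two of whose parallel sides
have the lengths of two opposite edges. -/
lemma exists_latticeBox_of_card_eq_four (hU : IsSmoothFan U s) (hcard : U.card = 4)
    {h : ℤ × ℤ → ℤ} {B : ℤ} (hlen : ∀ u ∈ U, edgeLen s h u ≤ B) :
    ∃ r ∈ U, -r ∈ U ∧ edgeLen s h (-r) = edgeLen s h r ∧ ∃ t c d, ldet r t = 1 ∧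
      supportRegion U h ⊆ latticeBox r t c d (edgeLen s h r) B := by
  obtain ⟨r, hr, hr'⟩ := hU.exists_opposite_of_card_eq_four hcard
  have e1 := hU.succ_succ_eq_neg hcard.le hr hr'
  have e2 := hU.succ_succ_eq_neg hcard.le hr' (by rwa [neg_neg])
  rw [neg_neg] at e2
  have ht := hU.mapsTo r hr
  have ht' := hU.mapsTo _ hr'
  have l1 := hlen _ ht
  have l2 := hlen _ ht'
  have hsum := hU.add_succ_succ ht
  -- The edge with normal `s r` joins the edges with normals r and -r, so its length is the width of
  -- the region in direction r.
  have hA : edgeLen s h r = -h r - h (-r) := by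
    rw [edgeLen, e1, ldet_neg_right, ldet_self]; ring
  have hA' : edgeLen s h (-r) = -h r - h (-r) := by
    rw [edgeLen, e2, ldet_neg_left, ldet_self]; ring
  simp only [edgeLen, e1, e2] at l1 l2
  rw [e1] at hsum
  rw [ldet_swap] at l2
  set t := s r
  set t' := s (-r)
  set k := ldet t t'
  refine ⟨r, hr, hr', by rw [hA, hA'], t, h r, h t, hU.ldet_eq r hr, ?_⟩
  intro x hx
  have x1 := hx r hr
  have x2 := hx _ hr'
  have x3 := hx t ht
  have x4 := hx t' ht'
  have x5 : latticePairing t x + latticePairing t' x = -(k * latticePairing r x) := by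
    rw [← latticePairing_add_left, hsum, latticePairing_smul_left, latticePairing_neg_left]; ring
  rw [latticePairing_neg_left] at x2
  refine ⟨x1, ?_, x3, ?_⟩
  · rw [hA]; push_cast; linarith
  · have l1' : (k : ℝ) * h (-r) - h t - h t' ≤ B := by exact_mod_cast l1
    have l2' : -(k : ℝ) * h r - h t' - h t ≤ B := by exact_mod_cast l2
    -- The region is a trapezoid with parallel sides on the lines normal to r; the sign of k tells
    -- which of them is the longer one, and that one bounds the extent in direction t.
    rcases le_total 0 k with hk | hk
    · have hk' : (0 : ℝ) ≤ k := by exact_mod_cast hk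
      have := mul_le_mul_of_nonneg_left x1 hk'
      linarith
    · have hk' : (k : ℝ) ≤ 0 := by exact_mod_cast hk
      have := mul_le_mul_of_nonpos_left x2 hk'
      linarith

/-- The region of a smooth polygon with at least five edges of length at most `b` lies in a lattice
parallelogram with small sides. -/
lemma exists_latticeBox_of_five_le_card (k : ℕ) : ∀ {U : Finset (ℤ × ℤ)} {s : ℤ × ℤ → ℤ × ℤ}
    {h : ℤ × ℤ → ℤ} {b : ℤ}, IsSmoothFan U s → U.card = k + 5 →
    (∀ u ∈ U, 1 ≤ edgeLen s h u ∧ edgeLen s h u ≤ b) →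
    ∃ r t c d A B, ldet r t = 1 ∧ supportRegion U h ⊆ latticeBox r t c d A B ∧ 0 ≤ A ∧ 0 ≤ B ∧
      A ≤ 2 ^ (k + 1) * b ∧ B ≤ 2 ^ (k + 1) * b ∧ 2 * (A * B) ≤ 4 ^ (k + 1) * b ^ 2 := by
  induction k with
  | zero =>
    intro U s h b hU hcard hlen
    obtain ⟨p, hp, hsum⟩ := hU.exists_blowdown hcard.ge
    have hm := hU.mapsTo p hp
    have hU' := hU.blowdown hp hsum
    have hlen' := hU.edgeLen_blowdown_mem hp hsum hlen
    obtain ⟨r, hr, hr', hrr, t, c, d, hrt, hbox⟩ := hU'.exists_latticeBox_of_card_eq_four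
      (by rw [Finset.card_erase_of_mem hm, hcard]) (fun u hu => (hlen' u hu).2)
    have hrU := Finset.mem_of_mem_erase hr
    have hrU' := Finset.mem_of_mem_erase hr'
    have hpos := (hlen' r hr).1
    -- The two prolonged edges are neighbours, so r and -r cannot both index one of them. Their
    -- edges have equal length in the new fan, and one of them is unchanged.
    have hA : edgeLen (Function.update s p (s (s p))) h r ≤ b := by
      have c1 := hU.ldet_eq r hrU
      have c2 := hU.ldet_eq _ hrU'
      by_cases h1 : r ≠ p ∧ s r ≠ p
      · rw [edgeLen_blowdown_of_ne h h1.1 h1.2]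
        exact (hlen r hrU).2
      · rw [← hrr, edgeLen_blowdown_of_ne h _ _]
        · exact (hlen _ hrU').2
        · intro h2
          apply h1
          constructor
          · intro h3
            rw [h3] at h2 c1 c2
            rw [ldet_neg_left, h2] at c2
            omega
          · intro h3
            rw [h3, ← h2, ldet_neg_right, ldet_self] at c1
            omega
        · intro h2
          apply h1
          constructor
          · intro h3
            rw [h2, ← h3, ldet_neg_left, ldet_self] at c2
            omega
          · intro h3
            have := hU.injOn _ hrU _ hrU' (h3.trans h2.symm)
            rw [← this] at c2
            rw [h3] at c1
            have h4 : r = 0 := by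
              ext
              · have := congrArg Prod.fst this; simp at this ⊢; omega
              · have := congrArg Prod.snd this; simp at this ⊢; omega
            rw [h4] at c1; simp [ldet] at c1
    have hb := (hlen p hp).1.trans (hlen p hp).2
    refine ⟨r, t, c, d, _, _, hrt, (supportRegion_subset_erase h _).trans hbox, by omega,
      by omega, by omega, by omega, ?_⟩
    rw [zero_add, pow_one]
    have := mul_le_mul_of_nonneg_right hA (zero_le_one.trans hb)
    nlinarith
  | succ k ih =>
    intro U s h b hU hcard hlen
    obtain ⟨p, hp, hsum⟩ := hU.exists_blowdown (by omega)
    have hm := hU.mapsTo p hp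
    -- The induction hypothesis is used with the edge bound `2 * b`.
    obtain ⟨r, t, c, d, A, B, hrt, hbox, hA0, hB0, hA, hB, hAB⟩ := ih (hU.blowdown hp hsum)
      (by rw [Finset.card_erase_of_mem hm, hcard]; omega) (hU.edgeLen_blowdown_mem hp hsum hlen)
    refine ⟨r, t, c, d, A, B, hrt, (supportRegion_subset_erase h _).trans hbox, hA0, hB0,
      hA.trans (le_of_eq ?_), hB.trans (le_of_eq ?_), hAB.trans (le_of_eq ?_)⟩ <;> ring

/-- For a fan with three rays the region is a triangle that is equivalent to a multiple of the
standard one. -/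
lemma exists_triangle_of_card_eq_three (hU : IsSmoothFan U s) (hcard : U.card = 3)
    (h : ℤ × ℤ → ℤ) : ∃ r ∈ U, ∃ (t : ℤ × ℤ) (c d : ℤ), ldet r t = 1 ∧ ∀ x ∈ supportRegion U h,
      c ≤ latticePairing r x ∧ d ≤ latticePairing t x ∧
      latticePairing r x + latticePairing t x ≤ c + d + edgeLen s h r := by
  obtain ⟨u, hu⟩ := hU.nonempty
  have hm := hU.mapsTo u hu
  have hq := hU.mapsTo _ hm
  have hz := hU.mapsTo _ hq
  have hset : ({u, s u, s (s u)} : Finset (ℤ × ℤ)) = U := by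
    apply Finset.eq_of_subset_of_card_le
    · intro x hx
      simp only [Finset.mem_insert, Finset.mem_singleton] at hx
      rcases hx with rfl | rfl | rfl <;> assumption
    · rw [hcard]
      exact (Finset.card_eq_three.2 ⟨u, s u, s (s u), (hU.succ_ne hu).symm,
        (hU.succ_succ_ne hu).symm, (hU.succ_ne hm).symm, rfl⟩).ge
  have hzu : s (s (s u)) = u := by
    rw [← hset] at hz
    simp only [Finset.mem_insert, Finset.mem_singleton] at hz
    rcases hz with h | h | h
    · exact h
    · exact absurd h (hU.succ_succ_ne hm)
    · exact absurd h (hU.succ_ne hq)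
  have c1 := hU.ldet_eq u hu
  have c2 := hU.ldet_eq _ hm
  have c3 := hU.ldet_eq _ hq
  rw [hzu] at c3
  have c4 : ldet u (s (s u)) = -1 := by rw [ldet_swap, c3]
  have hsum := hU.add_succ_succ hu
  rw [c4, neg_one_smul] at hsum
  refine ⟨u, hu, s u, h u, h (s u), c1, ?_⟩
  intro x hx
  refine ⟨hx u hu, hx _ hm, ?_⟩
  have x3 := hx _ hq
  have : s (s u) = -(u + s u) := by
    rw [neg_add, ← hsum]; abel
  rw [edgeLen, c4]
  rw [this, latticePairing_neg_left, latticePairing_add_left, ← this] at x3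
  push_cast
  linarith

end IsSmoothFan

/-! ### Unimodular cones in terms of determinants -/

/-- A lattice vector as a point of the plane. -/
def latticeVec (w : ℤ × ℤ) : Fin 2 → ℝ := ![(w.1 : ℝ), (w.2 : ℝ)]

lemma latticeVec_dotProduct (w : ℤ × ℤ) (x : Fin 2 → ℝ) :
    latticeVec w ⬝ᵥ x = latticePairing w x := by
  simp [latticeVec, latticePairing, dotProduct, Fin.sum_univ_two]

lemma latticeVec_mem (w : ℤ × ℤ) : latticeVec w ∈ intLattice 2 :=
  ⟨![w.1, w.2], by ext i; fin_cases i <;> simp [latticeVec]⟩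

lemma exists_latticeVec_eq {x : Fin 2 → ℝ} (hx : x ∈ intLattice 2) : ∃ w, latticeVec w = x := by
  obtain ⟨z, rfl⟩ := hx
  exact ⟨(z 0, z 1), by ext i; fin_cases i <;> simp [latticeVec]⟩

/-- `latticePairing` as a continuous linear functional. -/
noncomputable def latticeFunctional (u : ℤ × ℤ) : (Fin 2 → ℝ) →L[ℝ] ℝ :=
  (u.1 : ℝ) • ContinuousLinearMap.proj 0 + (u.2 : ℝ) • ContinuousLinearMap.proj 1

lemma latticeFunctional_apply (u : ℤ × ℤ) (x : Fin 2 → ℝ) :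
    latticeFunctional u x = latticePairing u x := by
  simp [latticeFunctional, latticePairing]

/-- The determinant of a lattice vector and a vector of the plane. -/
def realDet (u : ℤ × ℤ) (x : Fin 2 → ℝ) : ℝ := u.1 * x 1 - u.2 * x 0

lemma realDet_latticeVec (u w : ℤ × ℤ) : realDet u (latticeVec w) = ldet u w := by
  simp [realDet, latticeVec, ldet]

lemma realDet_add (u : ℤ × ℤ) (x y : Fin 2 → ℝ) :
    realDet u (x + y) = realDet u x + realDet u y := by
  simp only [realDet, Pi.add_apply]; ring

lemma realDet_smul (u : ℤ × ℤ) (k : ℝ) (x : Fin 2 → ℝ) :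
    realDet u (k • x) = k * realDet u x := by
  simp only [realDet, Pi.smul_apply, smul_eq_mul]; ring

/-- A cone spanned by a positively oriented lattice basis, in terms of determinants. -/
lemma latticeVec_mem_hull_pair_iff {a b : ℤ × ℤ} (hab : ldet a b = 1) (w : ℤ × ℤ) :
    latticeVec w ∈ PointedCone.hull ℝ {latticeVec a, latticeVec b} ↔
      0 ≤ ldet a w ∧ 0 ≤ ldet w b := by
  constructor
  · intro h
    have key : ∀ x ∈ PointedCone.hull ℝ {latticeVec a, latticeVec b},
        0 ≤ realDet a x ∧ realDet b x ≤ 0 := by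
      intro x hx
      induction hx using Submodule.span_induction with
      | mem x hx =>
        rcases hx with rfl | rfl
        · rw [realDet_latticeVec, realDet_latticeVec, ldet_self, ldet_swap a b, hab]; norm_num
        · rw [realDet_latticeVec, realDet_latticeVec, ldet_self, hab]; norm_num
      | zero => simp [realDet]
      | add x y _ _ hx hy =>
        rw [realDet_add, realDet_add]
        exact ⟨add_nonneg hx.1 hy.1, add_nonpos hx.2 hy.2⟩
      | smul k x _ hx =>
        change 0 ≤ realDet a ((k : ℝ) • x) ∧ realDet b ((k : ℝ) • x) ≤ 0
        rw [realDet_smul, realDet_smul]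
        exact ⟨mul_nonneg k.2 hx.1, mul_nonpos_of_nonneg_of_nonpos k.2 hx.2⟩
    obtain ⟨h1, h2⟩ := key _ h
    rw [realDet_latticeVec] at h1 h2
    have h1' : 0 ≤ ldet a w := by exact_mod_cast h1
    have h2' : ldet b w ≤ 0 := by exact_mod_cast h2
    exact ⟨h1', by rw [ldet_swap]; omega⟩
  · rintro ⟨h1, h2⟩
    have hw : latticeVec w = (⟨(ldet w b : ℝ), by exact_mod_cast h2⟩ : {c : ℝ // 0 ≤ c}) •
        latticeVec a + (⟨(ldet a w : ℝ), by exact_mod_cast h1⟩ : {c : ℝ // 0 ≤ c}) •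
        latticeVec b := by
      have h3 := eq_of_ldet_eq_one hab w
      have h4 : (w.1 : ℝ) = ldet w b * a.1 + ldet a w * b.1 := by
        exact_mod_cast congrArg Prod.fst h3
      have h5 : (w.2 : ℝ) = ldet w b * a.2 + ldet a w * b.2 := by
        exact_mod_cast congrArg Prod.snd h3
      ext i
      fin_cases i
      · simpa [latticeVec, Nonneg.mk_smul] using h4
      · simpa [latticeVec, Nonneg.mk_smul] using h5
    rw [hw]
    exact Submodule.add_mem _
      (Submodule.smul_mem _ _ (Submodule.subset_span (Set.mem_insert _ _)))
      (Submodule.smul_mem _ _ (Submodule.subset_span (Set.mem_insert_of_mem _ rfl)))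

/-- A planar unimodular cone with an interior point is spanned by a positively oriented lattice
basis. -/
lemma IsUnimodularCone.exists_basis {σ : Set (Fin 2 → ℝ)} (hσ : IsUnimodularCone σ)
    {w₀ : Fin 2 → ℝ} (h₀ : w₀ ∈ σ) (hint : ∀ z, ∃ ε : ℝ, 0 < ε ∧ w₀ + ε • z ∈ σ) :
    ∃ a b : ℤ × ℤ, ldet a b = 1 ∧
      ∀ w, latticeVec w ∈ σ ↔ 0 ≤ ldet a w ∧ 0 ≤ ldet w b := by
  obtain ⟨e, S, rfl⟩ := hσ
  set g : Fin 2 → ℤ × ℤ := fun j => (e j 0, e j 1) with hg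
  have hgv : (fun (j : Fin 2) (i : Fin 2) => (e j i : ℝ)) = fun j => latticeVec (g j) := by
    ext j i; fin_cases i <;> simp [latticeVec, hg]
  rw [hgv] at h₀ hint ⊢
  have hdet : ldet (g 0) (g 1) = 1 ∨ ldet (g 0) (g 1) = -1 := by
    have h1 := (Pi.basisFun ℤ (Fin 2)).isUnit_det e
    rw [Pi.basisFun_det_apply, Int.isUnit_iff, Matrix.det_fin_two] at h1
    simp only [Matrix.of_apply] at h1
    simp only [ldet, hg]
    convert h1 using 2
  -- With a generator missing, the cone would lie on the line through some `g j`, and moving the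
  -- interior point perpendicularly to `g j` would leave it.
  have hS : S = Set.univ := by
    by_contra hne
    obtain ⟨i, hi⟩ := (Set.ne_univ_iff_exists_notMem S).1 hne
    obtain ⟨j, hj⟩ : ∃ j, ∀ k ∈ S, k = j := by
      fin_cases i
      · exact ⟨1, fun k hk => by fin_cases k; exacts [absurd hk hi, rfl]⟩
      · exact ⟨0, fun k hk => by fin_cases k; exacts [rfl, absurd hk hi]⟩
    have key : ∀ x ∈ PointedCone.hull ℝ ((fun j => latticeVec (g j)) '' S),
        realDet (g j) x = 0 := by
      intro x hx
      induction hx using Submodule.span_induction with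
      | mem x hx =>
        obtain ⟨k, hk, rfl⟩ := hx
        change realDet (g j) (latticeVec (g k)) = 0
        rw [hj k hk, realDet_latticeVec, ldet_self, Int.cast_zero]
      | zero => simp [realDet]
      | add x y _ _ hx hy => rw [realDet_add, hx, hy, add_zero]
      | smul k x _ hx =>
        change realDet (g j) ((k : ℝ) • x) = 0
        rw [realDet_smul, hx, mul_zero]
    obtain ⟨ε, hε, hmem⟩ := hint ![-((g j).2 : ℝ), ((g j).1 : ℝ)]
    have h1 := key _ hmem
    rw [realDet_add, key _ h₀, realDet_smul, zero_add] at h1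
    have h2 := (mul_eq_zero.1 h1).resolve_left hε.ne'
    simp only [realDet, Matrix.cons_val_zero, Matrix.cons_val_one] at h2
    obtain ⟨h3, h4⟩ := mul_self_add_mul_self_eq_zero.1
      (show ((g j).1 : ℝ) * (g j).1 + (g j).2 * (g j).2 = 0 by linarith)
    have h3' : (g j).1 = 0 := by exact_mod_cast h3
    have h4' : (g j).2 = 0 := by exact_mod_cast h4
    fin_cases j <;> simp only [ldet] at hdet <;> simp_all
  have himage : (fun j => latticeVec (g j)) '' S = {latticeVec (g 0), latticeVec (g 1)} := by
    rw [hS, Set.image_univ]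
    ext x
    simp [Fin.exists_fin_two, eq_comm]
  rw [himage]
  rcases hdet with h | h
  · exact ⟨g 0, g 1, h, fun w => latticeVec_mem_hull_pair_iff h w⟩
  · have h' : ldet (g 1) (g 0) = 1 := by rw [ldet_swap]; omega
    refine ⟨g 1, g 0, h', fun w => ?_⟩
    rw [Set.pair_comm]
    exact latticeVec_mem_hull_pair_iff h' w

/-! ### Vertices of lattice polytopes and their normal cones -/

section Polytope

variable {d : ℕ} {P : Set (Fin d → ℝ)}

lemma IsLatticePolytope.isCompact (hP : IsLatticePolytope P) : IsCompact P := by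
  obtain ⟨V, hV, -, -, rfl⟩ := hP
  exact hV.isCompact_convexHull ℝ

lemma IsLatticePolytope.convex (hP : IsLatticePolytope P) : Convex ℝ P := by
  obtain ⟨V, -, -, -, rfl⟩ := hP
  exact convex_convexHull ℝ V

lemma IsLatticePolytope.nonempty (hP : IsLatticePolytope P) : P.Nonempty := by
  obtain ⟨V, -, hV, -, rfl⟩ := hP
  exact hV.convexHull

lemma IsLatticePolytope.finite_extremePoints (hP : IsLatticePolytope P) :
    (P.extremePoints ℝ).Finite := by
  obtain ⟨V, hV, -, -, rfl⟩ := hP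
  exact hV.subset extremePoints_convexHull_subset

lemma IsLatticePolytope.extremePoints_subset (hP : IsLatticePolytope P) :
    P.extremePoints ℝ ⊆ intLattice d := by
  obtain ⟨V, -, -, hV, rfl⟩ := hP
  exact extremePoints_convexHull_subset.trans hV

lemma IsLatticePolytope.convexHull_extremePoints (hP : IsLatticePolytope P) :
    convexHull ℝ (P.extremePoints ℝ) = P := by
  rw [← (hP.finite_extremePoints.isClosed_convexHull ℝ).closure_eq]
  exact closure_convexHull_extremePoints hP.isCompact hP.convex

lemma IsLatticePolytope.finite_inter_intLattice (hP : IsLatticePolytope P) :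
    (P ∩ intLattice d).Finite := by
  obtain ⟨R, hR⟩ := hP.isCompact.isBounded.exists_norm_le
  refine ((Set.finite_Icc (fun _ => -⌈R⌉ : Fin d → ℤ) (fun _ => ⌈R⌉)).image
    (fun (z : Fin d → ℤ) (i : Fin d) => (z i : ℝ))).subset ?_
  rintro _ ⟨hx, z, rfl⟩
  refine ⟨z, ?_, rfl⟩
  have h1 : ∀ i, |(z i : ℝ)| ≤ ⌈R⌉ := fun i =>
    ((norm_le_pi_norm (fun i => (z i : ℝ)) i).trans (hR _ hx)).trans (Int.le_ceil R)
  constructor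
  · intro i
    have := (abs_le.1 (h1 i)).1
    exact_mod_cast this
  · intro i
    have := (abs_le.1 (h1 i)).2
    exact_mod_cast this

/-- A vertex of a lattice polytope is the unique minimum of some linear functional. -/
lemma IsLatticePolytope.exists_lt (hP : IsLatticePolytope P) {v : Fin d → ℝ}
    (hv : v ∈ P.extremePoints ℝ) : ∃ f : StrongDual ℝ (Fin d → ℝ), ∀ x ∈ P, x ≠ v → f v < f x := by
  set V := P.extremePoints ℝ with hVdef
  have hfin : (V \ {v}).Finite := hP.finite_extremePoints.subset Set.sdiff_subset
  have hnot : v ∉ convexHull ℝ (V \ {v}) :=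
    convexIndependent_set_iff_notMem_convexHull_sdiff.1
      hP.convex.convexIndependent_extremePoints v hv
  rcases (V \ {v}).eq_empty_or_nonempty with he | hne
  · refine ⟨0, fun x hx hxv => ?_⟩
    rw [← hP.convexHull_extremePoints, ← hVdef] at hx
    have hsub : V ⊆ {v} := Set.sdiff_eq_empty.1 he
    have := convexHull_mono hsub hx
    rw [convexHull_singleton] at this
    exact absurd this hxv
  -- f separates v from the hull of the other vertices. A point of P other than v is a convex
  -- combination of v and a point of this hull with positive weight on the latter.
  · obtain ⟨f, u, hfu, hub⟩ := geometric_hahn_banach_point_closed (convex_convexHull ℝ (V \ {v}))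
      (hfin.isClosed_convexHull ℝ) hnot
    refine ⟨f, fun x hx hxv => ?_⟩
    have hins : insert v (V \ {v}) = V := Set.insert_sdiff_self_of_mem hv
    rw [← hP.convexHull_extremePoints, ← hVdef, ← hins, convexHull_insert hne] at hx
    obtain ⟨v', hv', y, hy, hxy⟩ := mem_convexJoin.1 hx
    rw [Set.mem_singleton_iff] at hv'
    rw [hv'] at hxy
    obtain ⟨α, β, hα, hβ, hαβ, rfl⟩ := hxy
    have hfy := hfu.trans (hub y hy)
    rcases hβ.eq_or_lt with h | h
    · exfalso
      apply hxv
      rw [← h] at hαβ ⊢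
      rw [add_zero] at hαβ
      rw [hαβ]; simp
    · rw [map_add, map_smul, map_smul, smul_eq_mul, smul_eq_mul]
      have : f v = α * f v + β * f v := by rw [← add_mul, hαβ, one_mul]
      nlinarith

end Polytope

/-- The normal cone of a smooth lattice polygon at a vertex is spanned by a lattice basis. -/
lemma IsSmoothPolygon.exists_basis_normalCone {P : Set (Fin 2 → ℝ)} (hP : IsSmoothPolygon P)
    {v : Fin 2 → ℝ} (hv : v ∈ P.extremePoints ℝ) :
    ∃ a b : ℤ × ℤ, ldet a b = 1 ∧
      ∀ w, (∀ x ∈ P, latticePairing w v ≤ latticePairing w x) ↔ 0 ≤ ldet a w ∧ 0 ≤ ldet w b := by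
  have hL := hP.1.1
  obtain ⟨f, hf⟩ := hL.exists_lt hv
  have hvP : v ∈ P := hv.1
  have hface : IsFace P {v} := by
    refine ⟨Set.singleton_nonempty v, fun _ => ⟨-f, ?_⟩⟩
    ext x
    simp only [Set.mem_singleton_iff, Set.mem_ofPred_eq, neg_apply, neg_le_neg_iff]
    constructor
    · rintro rfl
      refine ⟨hvP, fun y hy => ?_⟩
      by_cases h : y = x
      · rw [h]
      · exact (hf y hy h).le
    · rintro ⟨hx, hmin⟩
      by_contra h
      exact (hf x hx h).not_ge (hmin v hvP)
  have hmem : ∀ w, w ∈ normalCone P {v} ↔ ∀ x ∈ P.extremePoints ℝ, w ⬝ᵥ v ≤ w ⬝ᵥ x := by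
    intro w
    simp only [normalCone, Set.mem_singleton_iff, forall_eq, Set.mem_ofPred_eq]
    refine ⟨fun h x hx => h x hx.1, fun h x hx => ?_⟩
    have hconv : Convex ℝ {x | w ⬝ᵥ v ≤ w ⬝ᵥ x} :=
      convex_halfSpace_ge (f := fun x => w ⬝ᵥ x)
        ⟨fun x y => dotProduct_add w x y, fun c x => dotProduct_smul c w x⟩ _
    rw [← hL.convexHull_extremePoints] at hx
    exact convexHull_min h hconv hx
  set w₀ : Fin 2 → ℝ := fun i => f (Pi.single i 1) with hw₀
  have hfw : ∀ x, f x = w₀ ⬝ᵥ x := by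
    intro x
    conv_lhs => rw [← Finset.univ_sum_single x]
    rw [map_sum, dotProduct]
    refine Finset.sum_congr rfl fun i _ => ?_
    rw [hw₀, mul_comm, ← smul_eq_mul, ← map_smul, ← Pi.single_smul, smul_eq_mul, mul_one]
  -- `w₀` is interior to the normal cone: only finitely many vertices matter, and the strict
  -- inequalities there survive small perturbations.
  have hint : ∀ z, ∃ ε : ℝ, 0 < ε ∧ w₀ + ε • z ∈ normalCone P {v} := by
    intro z
    have hev : ∀ᶠ ε : ℝ in nhdsWithin 0 (Set.Ioi 0), ∀ x ∈ P.extremePoints ℝ,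
        (w₀ + ε • z) ⬝ᵥ v ≤ (w₀ + ε • z) ⬝ᵥ x := by
      rw [Filter.eventually_all_finite hL.finite_extremePoints]
      intro x hx
      by_cases h : x = v
      · rw [h]; exact Filter.Eventually.of_forall fun _ => le_rfl
      have hlt := hf x hx.1 h
      rw [hfw, hfw] at hlt
      have hc : ∀ y : Fin 2 → ℝ, Continuous fun ε : ℝ => (w₀ + ε • z) ⬝ᵥ y := by
        intro y
        simp only [dotProduct, Fin.sum_univ_two, Pi.add_apply, Pi.smul_apply, smul_eq_mul]
        fun_prop
      have : ∀ᶠ ε : ℝ in nhds 0, (w₀ + ε • z) ⬝ᵥ v < (w₀ + ε • z) ⬝ᵥ x :=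
        (hc v).continuousAt.eventually_lt (hc x).continuousAt (by simpa using hlt)
      exact (this.filter_mono nhdsWithin_le_nhds).mono fun _ h => h.le
    obtain ⟨ε, h1, h2⟩ := (hev.and self_mem_nhdsWithin).exists
    exact ⟨ε, h2, (hmem _).2 h1⟩
  have h0 : w₀ ∈ normalCone P {v} := by
    rw [hmem]
    intro x hx
    by_cases h : x = v
    · rw [h]
    · rw [← hfw, ← hfw]; exact (hf x hx.1 h).le
  obtain ⟨a, b, hab, h⟩ := (hP.2 _ ⟨{v}, hface, rfl⟩).exists_basis h0 hint
  refine ⟨a, b, hab, fun w => ?_⟩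
  rw [← h]
  simp only [normalCone, Set.mem_singleton_iff, forall_eq, Set.mem_ofPred_eq, latticeVec_dotProduct]

/-! ### From vertex cones to a smooth fan -/

/-- The normal cones of a polygon `P` with vertex set `V`: the functionals minimal at `v` form the
cone spanned by the positively oriented lattice basis `a v`, `b v`. -/
structure HasVertexCones (P : Set (Fin 2 → ℝ)) (V : Finset (Fin 2 → ℝ))
    (a b : (Fin 2 → ℝ) → ℤ × ℤ) : Prop where
  subset : ∀ v ∈ V, v ∈ P
  exists_min : ∀ w, ∃ v ∈ V, ∀ x ∈ P, latticePairing w v ≤ latticePairing w x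
  ldet_eq : ∀ v ∈ V, ldet (a v) (b v) = 1
  mem_iff : ∀ v ∈ V, ∀ w, (∀ x ∈ P, latticePairing w v ≤ latticePairing w x) ↔
    0 ≤ ldet (a v) w ∧ 0 ≤ ldet w (b v)

lemma IsSmoothPolygon.exists_hasVertexCones {P : Set (Fin 2 → ℝ)} (hP : IsSmoothPolygon P) :
    ∃ a b, HasVertexCones P hP.1.1.finite_extremePoints.toFinset a b := by
  have hL := hP.1.1
  choose! a b h using fun v (hv : v ∈ P.extremePoints ℝ) => hP.exists_basis_normalCone hv
  refine ⟨a, b, fun v hv => ?_, fun w => ?_, fun v hv => ?_, fun v hv => ?_⟩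
  · exact ((Set.Finite.mem_toFinset _).1 hv).1
  · have hne : hL.finite_extremePoints.toFinset.Nonempty := by
      rw [Set.Finite.toFinset_nonempty, ← convexHull_nonempty_iff (𝕜 := ℝ),
        hL.convexHull_extremePoints]
      exact hL.nonempty
    obtain ⟨v, hv, hmin⟩ := hL.finite_extremePoints.toFinset.exists_min_image (latticePairing w) hne
    refine ⟨v, hv, fun x hx => ?_⟩
    have hconv : Convex ℝ {x | latticePairing w v ≤ latticePairing w x} :=
      convex_halfSpace_ge (f := latticePairing w)
        ⟨fun x y => by simp only [latticePairing, Pi.add_apply]; ring,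
          fun c x => by simp only [latticePairing, Pi.smul_apply, smul_eq_mul]; ring⟩ _
    rw [← hL.convexHull_extremePoints] at hx
    exact convexHull_min (fun y hy => hmin y (by simpa using hy)) hconv hx
  · exact (h v ((Set.Finite.mem_toFinset _).1 hv)).1
  · exact (h v ((Set.Finite.mem_toFinset _).1 hv)).2

/-- Cramer's rule. -/
lemma ext_latticePairing {a b : ℤ × ℤ} (hab : ldet a b = 1) {x y : Fin 2 → ℝ}
    (h₁ : latticePairing a x = latticePairing a y) (h₂ : latticePairing b x = latticePairing b y) :
    x = y := by
  have h : (a.1 : ℝ) * b.2 - a.2 * b.1 = 1 := by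
    have : a.1 * b.2 - a.2 * b.1 = 1 := hab
    exact_mod_cast this
  simp only [latticePairing] at h₁ h₂
  ext i
  fin_cases i
  · change x 0 = y 0
    linear_combination b.2 * h₁ - a.2 * h₂ - (x 0 - y 0) * h
  · change x 1 = y 1
    linear_combination a.1 * h₂ - b.1 * h₁ - (x 1 - y 1) * h

namespace HasVertexCones

variable {P : Set (Fin 2 → ℝ)} {V : Finset (Fin 2 → ℝ)} {a b : (Fin 2 → ℝ) → ℤ × ℤ}

lemma left_mem (hV : HasVertexCones P V a b) {v : Fin 2 → ℝ} (hv : v ∈ V) :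
    ∀ x ∈ P, latticePairing (a v) v ≤ latticePairing (a v) x :=
  (hV.mem_iff v hv _).2 ⟨(ldet_self _).ge, (hV.ldet_eq v hv).symm ▸ zero_le_one⟩

lemma right_mem (hV : HasVertexCones P V a b) {v : Fin 2 → ℝ} (hv : v ∈ V) :
    ∀ x ∈ P, latticePairing (b v) v ≤ latticePairing (b v) x :=
  (hV.mem_iff v hv _).2 ⟨(hV.ldet_eq v hv).symm ▸ zero_le_one, (ldet_self _).ge⟩

/-- A functional in the interior of the normal cone of a vertex is minimal only at this vertex. -/
lemma eq_of_interior (hV : HasVertexCones P V a b) {v : Fin 2 → ℝ} (hv : v ∈ V) {w : ℤ × ℤ}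
    (h₁ : 0 < ldet (a v) w) (h₂ : 0 < ldet w (b v)) {x : Fin 2 → ℝ} (hx : x ∈ P)
    (hmin : latticePairing w x ≤ latticePairing w v) : x = v := by
  have hw : w = ldet w (b v) • a v + ldet (a v) w • b v := by
    conv_lhs => rw [eq_of_ldet_eq_one (hV.ldet_eq v hv) w]
    ext <;> simp
  have ha := hV.left_mem hv x hx
  have hb := hV.right_mem hv x hx
  rw [hw] at hmin
  simp only [latticePairing_add_left, latticePairing_smul_left] at hmin
  have h1 : (0 : ℝ) < ldet (a v) w := by exact_mod_cast h₁
  have h2 : (0 : ℝ) < ldet w (b v) := by exact_mod_cast h₂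
  have e1 := mul_nonneg h1.le (sub_nonneg.2 hb)
  have e2 := mul_nonneg h2.le (sub_nonneg.2 ha)
  have f1 : (ldet (a v) w : ℝ) * (latticePairing (b v) x - latticePairing (b v) v) = 0 := by
    linarith
  have f2 : (ldet w (b v) : ℝ) * (latticePairing (a v) x - latticePairing (a v) v) = 0 := by
    linarith
  exact ext_latticePairing (hV.ldet_eq v hv)
    (sub_eq_zero.1 ((mul_eq_zero.1 f2).resolve_left h2.ne'))
    (sub_eq_zero.1 ((mul_eq_zero.1 f1).resolve_left h1.ne'))

/-- If two vertices share their first generator, the functional `M • a v + b v` lies inside both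
cones for large M, but such a functional has only one minimum. -/
lemma injOn (hV : HasVertexCones P V a b) : Set.InjOn a V := by
  intro v hv v' hv' h
  have c := hV.ldet_eq v hv
  have c' := hV.ldet_eq v' hv'
  rw [← h] at c'
  obtain ⟨M, hM0, hM⟩ : ∃ M : ℤ, 0 < M ∧ 0 < M + ldet (b v) (b v') :=
    ⟨|ldet (b v) (b v')| + 1, by positivity, by
      have := neg_abs_le (ldet (b v) (b v')); omega⟩
  have ha1 : ∀ w, ldet (M • a v + b v) w = M * ldet (a v) w + ldet (b v) w := by
    intro w
    simp only [ldet, Prod.fst_add, Prod.snd_add, Prod.smul_fst, Prod.smul_snd, smul_eq_mul]; ring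
  have ha2 : ldet (a v) (M • a v + b v) = 1 := by
    rw [ldet_swap, ha1, ldet_self, ldet_swap, c]; ring
  refine (hV.eq_of_interior hv' (w := M • a v + b v) ?_ ?_ (hV.subset v hv) ?_)
  · rw [← h, ha2]; exact one_pos
  · rw [ha1, c', mul_one]; exact hM
  · refine (hV.mem_iff v hv _).2 ⟨?_, ?_⟩ v' (hV.subset v' hv')
    · rw [ha2]; exact zero_le_one
    · rw [ha1, c, ldet_self]; omega

/-- The second generator of the normal cone of a vertex is the first one for another vertex. -/
lemma exists_next (hV : HasVertexCones P V a b) {v : Fin 2 → ℝ} (hv : v ∈ V) :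
    ∃ v' ∈ V, a v' = b v := by
  have c := hV.ldet_eq v hv
  -- These functionals approach the ray of `b v` from outside the cone of v. One vertex v' minimises
  -- infinitely many of them, hence also their limiting direction `b v`.
  choose F hFV hF using fun M : ℕ => hV.exists_min ((M : ℤ) • b v - a v)
  have hfreq : ∃ v' ∈ V, ∃ᶠ M in Filter.atTop, F M = v' := by
    by_contra! hc
    have h1 : ∀ᶠ M in Filter.atTop, ∀ v' ∈ V, F M ≠ v' := by
      rw [Filter.eventually_all_finset]
      exact hc
    obtain ⟨M, hM⟩ := h1.exists
    exact hM _ (hFV M) rfl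
  obtain ⟨v', hv', hfr⟩ := hfreq
  have c' := hV.ldet_eq v' hv'
  have hlim : ∀ x ∈ P, latticePairing (b v) v' ≤ latticePairing (b v) x := by
    intro x hx
    by_contra! hlt
    obtain ⟨M₀, hM₀⟩ := exists_nat_gt ((latticePairing (a v) v' - latticePairing (a v) x) /
      (latticePairing (b v) v' - latticePairing (b v) x))
    obtain ⟨M, hM, hFM⟩ := (Filter.frequently_atTop.1 hfr) M₀
    have h1 := hF M x hx
    rw [hFM, sub_eq_add_neg] at h1
    simp only [latticePairing_add_left, latticePairing_smul_left, latticePairing_neg_left,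
      Int.cast_natCast] at h1
    rw [div_lt_iff₀ (sub_pos.2 hlt)] at hM₀
    have h2 : (M₀ : ℝ) ≤ M := by exact_mod_cast hM
    have h3 := mul_le_mul_of_nonneg_right h2 (sub_pos.2 hlt).le
    linarith
  obtain ⟨d1, d2⟩ := (hV.mem_iff v' hv' _).1 hlim
  obtain ⟨M, -, hFM⟩ := (Filter.frequently_atTop.1 hfr) 0
  have hM := (hV.mem_iff v' hv' _).1 (hFM ▸ hF M)
  refine ⟨v', hv', ?_⟩
  -- Since `b v` is also minimal at v, it cannot be interior to the cone of v'.
  have hnot : ¬ (0 < ldet (a v') (b v) ∧ 0 < ldet (b v) (b v')) := by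
    rintro ⟨h1, h2⟩
    have := hV.eq_of_interior hv' h1 h2 (hV.subset v hv) (hV.right_mem hv v' (hV.subset v' hv'))
    rw [← this, ldet_self] at h2
    exact h2.false
  have cb : ldet (b v) (-a v) = 1 := by rw [ldet_neg_right, ldet_swap]; omega
  have cb' : ldet (b v') (-a v') = 1 := by rw [ldet_neg_right, ldet_swap]; omega
  rcases d1.eq_or_lt with h1 | h1
  · have hne : 0 < ldet (b v) (b v') := by
      rcases d2.eq_or_lt with h2 | h2
      · exfalso
        have := eq_of_ldet_eq_one c' (b v)
        rw [← h1, ← h2] at this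
        rw [this] at c
        simp [ldet] at c
      · exact h2
    exact (eq_of_ldet_eq_zero c' cb h1.symm hne).symm
  · exfalso
    have h2 : ldet (b v) (b v') = 0 := by
      by_contra h; exact hnot ⟨h1, lt_of_le_of_ne d2 (Ne.symm h)⟩
    have h3 : b v = b v' := by
      refine eq_of_ldet_eq_zero cb' cb ?_ ?_
      · rw [ldet_swap, h2, neg_zero]
      · rw [ldet_neg_right, ldet_swap]; omega
    -- If `b v` were the second generator at v', the functional `M • b v - a v` would lie beyond it,
    -- with determinant -1.
    have h4 := hM.2
    rw [← h3, sub_eq_add_neg, ldet_add_left, ldet_neg_left, c] at h4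
    simp only [ldet, Prod.smul_fst, Prod.smul_snd, smul_eq_mul] at h4
    nlinarith

/-- The successor of a ray generator of the normal fan. -/
noncomputable def succ (_ : HasVertexCones P V a b) (u : ℤ × ℤ) : ℤ × ℤ :=
  b (Function.invFunOn a V u)

lemma succ_left (hV : HasVertexCones P V a b) {v : Fin 2 → ℝ} (hv : v ∈ V) :
    hV.succ (a v) = b v := by
  rw [succ, hV.injOn.leftInvOn_invFunOn hv]

/-- Completeness holds because every functional is minimal at some vertex. A generator strictly
inside the cone of v is minimal only at v, whereas it is minimal at its own vertex. -/
lemma isSmoothFan (hV : HasVertexCones P V a b) : IsSmoothFan (V.image a) hV.succ := by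
  refine ⟨?_, ?_, ?_, ?_⟩
  · intro u hu
    obtain ⟨v, hv, rfl⟩ := Finset.mem_image.1 hu
    obtain ⟨v', hv', h⟩ := hV.exists_next hv
    rw [hV.succ_left hv, ← h]
    exact Finset.mem_image_of_mem a hv'
  · intro u hu
    obtain ⟨v, hv, rfl⟩ := Finset.mem_image.1 hu
    rw [hV.succ_left hv, hV.ldet_eq v hv]
  · intro u hu u' hu' h1 h2
    obtain ⟨v, hv, rfl⟩ := Finset.mem_image.1 hu
    obtain ⟨v', hv', rfl⟩ := Finset.mem_image.1 hu'
    rw [hV.succ_left hv] at h2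
    have := hV.eq_of_interior hv h1 h2 (hV.subset v' hv') (hV.left_mem hv' v (hV.subset v hv))
    rw [this, ldet_self] at h1
    exact h1.false
  · intro w
    obtain ⟨v, hv, hmin⟩ := hV.exists_min w
    refine ⟨a v, Finset.mem_image_of_mem a hv, ?_⟩
    rw [hV.succ_left hv]
    exact (hV.mem_iff v hv w).1 hmin

end HasVertexCones

/-! ### Edges, their lattice lengths and the fan of a polygon -/

/-- The face of `P` on which an integral functional takes a given value. -/
def latticeFace (P : Set (Fin 2 → ℝ)) (m : ℤ × ℤ) (k : ℤ) : Set (Fin 2 → ℝ) :=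
  {x ∈ P | latticePairing m x = k}

/-- A supporting line through two lattice points cuts out an edge, at least as long as the distance
of these points. -/
lemma isEdge_latticeFace {P : Set (Fin 2 → ℝ)} (hP : IsLatticePolytope P) {p m y y' : ℤ × ℤ}
    {k l : ℤ} (hpm : ldet p m = 1) (hy : latticeVec y ∈ P) (hy' : latticeVec y' ∈ P)
    (hyy : y' = y + l • (m.2, -m.1)) (hl : 0 < l) (hk : latticePairing m (latticeVec y) = k)
    (hmin : ∀ x ∈ P, (k : ℝ) ≤ latticePairing m x) :
    IsEdge P (latticeFace P m k) ∧ l ≤ latticeLength (latticeFace P m k) := by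
  have hface : IsFace P (latticeFace P m k) := by
    refine ⟨⟨_, hy, hk⟩, fun _ => ⟨-latticeFunctional m, ?_⟩⟩
    ext x
    simp only [latticeFace, Set.mem_ofPred_eq, neg_apply, neg_le_neg_iff, latticeFunctional_apply]
    refine and_congr_right fun hx => ⟨fun h z hz => h ▸ hmin z hz, fun h => ?_⟩
    exact le_antisymm (hk ▸ h _ hy) (hmin x hx)
  set e := latticeVec (m.2, -m.1) with he
  have hline : ∀ j : ℤ, latticeVec (y + j • (m.2, -m.1)) = latticeVec y + (j : ℝ) • e := by
    intro j
    ext i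
    fin_cases i <;> simp [latticeVec, he]
  have hme : ∀ (x : Fin 2 → ℝ) (c : ℝ),
      latticePairing m (x + c • e) = latticePairing m x := by
    intro x c
    simp [latticePairing, he, latticeVec]; ring
  have hmem : ∀ j : ℤ, 0 ≤ j → j ≤ l → latticeVec (y + j • (m.2, -m.1)) ∈ latticeFace P m k := by
    intro j hj hjl
    refine ⟨?_, by rw [hline, hme, hk]⟩
    have hl' : (0 : ℝ) < l := by exact_mod_cast hl
    have := hP.convex.add_smul_sub_mem hy hy' (t := (j : ℝ) / l)
      ⟨div_nonneg (by exact_mod_cast hj) hl'.le, (div_le_one hl').2 (by exact_mod_cast hjl)⟩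
    rwa [hyy, hline, add_sub_cancel_left, smul_smul, div_mul_cancel₀ _ hl'.ne', ← hline] at this
  have he0 : e ≠ 0 := by
    intro h0
    have h1 := congrFun h0 0
    have h2 := congrFun h0 1
    simp only [he, latticeVec, Matrix.cons_val_zero, Matrix.cons_val_one, Pi.zero_apply,
      Int.cast_eq_zero, neg_eq_zero] at h1 h2
    simp [ldet, h1, h2] at hpm
  have hvs : vectorSpan ℝ (latticeFace P m k) = Submodule.span ℝ {e} := by
    apply le_antisymm
    · rw [vectorSpan_def, Submodule.span_le]
      rintro _ ⟨x, hx, z, hz, rfl⟩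
      rw [SetLike.mem_coe, Submodule.mem_span_singleton]
      refine ⟨latticePairing p x - latticePairing p z, ?_⟩
      have h1 : latticePairing m x - latticePairing m z = 0 := by rw [hx.2, hz.2, sub_self]
      have h2 : (p.1 : ℝ) * m.2 - p.2 * m.1 = 1 := by
        have : p.1 * m.2 - p.2 * m.1 = 1 := hpm
        exact_mod_cast this
      simp only [latticePairing] at h1 ⊢
      ext i
      fin_cases i
      · simp only [he, latticeVec, Pi.smul_apply, smul_eq_mul, vsub_eq_sub, Pi.sub_apply]
        simp only [Fin.zero_eta, Matrix.cons_val_zero]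
        linear_combination (x 0 - z 0) * h2 + (p.2 : ℝ) * h1
      · simp only [he, latticeVec, Pi.smul_apply, smul_eq_mul, vsub_eq_sub, Pi.sub_apply]
        simp only [Fin.mk_one, Matrix.cons_val_one]
        push_cast
        linear_combination (x 1 - z 1) * h2 - (p.1 : ℝ) * h1
    · rw [Submodule.span_singleton_le_iff_mem]
      have h1 := vsub_mem_vectorSpan ℝ (hmem 1 zero_le_one hl) (hmem 0 le_rfl hl.le)
      rw [hline, hline] at h1
      simpa using h1
  refine ⟨⟨hface, by rw [hvs, finrank_span_singleton he0]⟩, ?_⟩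
  have hinj : Function.Injective fun j : ℕ => latticeVec (y + (j : ℤ) • (m.2, -m.1)) := by
    intro i j hij
    simp only [hline] at hij
    have := smul_left_injective ℝ he0 (add_left_cancel hij)
    exact_mod_cast this
  -- `ncard` vanishes on infinite sets, so bounding it from below requires finiteness.
  have hfin : (latticeFace P m k ∩ intLattice 2).Finite :=
    hP.finite_inter_intLattice.subset (Set.inter_subset_inter_left _ fun x hx => hx.1)
  have hsub : (fun j : ℕ => latticeVec (y + (j : ℤ) • (m.2, -m.1))) ''
      (Finset.range (l.toNat + 1) : Set ℕ) ⊆ latticeFace P m k ∩ intLattice 2 := by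
    rintro _ ⟨j, hj, rfl⟩
    rw [Finset.mem_coe, Finset.mem_range] at hj
    exact ⟨hmem j (by omega) (by omega), latticeVec_mem _⟩
  have hcard := Set.ncard_le_ncard hsub hfin
  rw [Set.ncard_image_of_injective _ hinj, Set.ncard_coe_finset, Finset.card_range] at hcard
  rw [latticeLength]
  omega

/-- The combinatorial data of a smooth polygon. -/
theorem IsSmoothPolygon.exists_isSmoothFan {P : Set (Fin 2 → ℝ)} (hP : IsSmoothPolygon P) :
    ∃ U s h, IsSmoothFan U s ∧ U.card = numVertices P ∧ P ⊆ supportRegion U h ∧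
      ∀ u ∈ U, IsEdge P (latticeFace P (s u) (h (s u))) ∧ 1 ≤ edgeLen s h u ∧
        edgeLen s h u ≤ latticeLength (latticeFace P (s u) (h (s u))) := by
  obtain ⟨a, b, hV⟩ := hP.exists_hasVertexCones
  set V := hP.1.1.finite_extremePoints.toFinset with hVdef
  choose! z hz using fun v (hv : v ∈ V) => exists_latticeVec_eq
    (hP.1.1.extremePoints_subset ((Set.Finite.mem_toFinset _).1 hv))
  have hcast : ∀ u v, v ∈ V →
      ((u.1 * (z v).1 + u.2 * (z v).2 : ℤ) : ℝ) = latticePairing u v := by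
    intro u v hv
    conv_rhs => rw [← hz v hv]
    simp [latticePairing, latticeVec]
  -- The support number of a generator is its value at the vertex whose cone has it as first
  -- generator; values outside the fan are irrelevant.
  set h : ℤ × ℤ → ℤ := fun u => u.1 * (z (Function.invFunOn a V u)).1 +
    u.2 * (z (Function.invFunOn a V u)).2 with hh
  have hleft : ∀ v ∈ V, h (a v) = (a v).1 * (z v).1 + (a v).2 * (z v).2 := by
    intro v hv
    rw [hh]
    simp only
    rw [hV.injOn.leftInvOn_invFunOn hv]
  have hleft' : ∀ v ∈ V, (h (a v) : ℝ) = latticePairing (a v) v := by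
    intro v hv
    rw [hleft v hv, hcast _ v hv]
  refine ⟨V.image a, hV.succ, h, hV.isSmoothFan, ?_, ?_, ?_⟩
  · rw [Finset.card_image_of_injOn hV.injOn, numVertices, hVdef,
      Set.ncard_eq_toFinset_card _ hP.1.1.finite_extremePoints]
  · intro x hx u hu
    obtain ⟨v, hv, rfl⟩ := Finset.mem_image.1 hu
    rw [hleft' v hv]
    exact hV.left_mem hv x hx
  · intro u hu
    obtain ⟨v, hv, rfl⟩ := Finset.mem_image.1 hu
    obtain ⟨v', hv', hvv⟩ := hV.exists_next hv
    obtain ⟨v'', hv'', hvv'⟩ := hV.exists_next hv'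
    have c := hV.ldet_eq v hv
    have c' := hV.ldet_eq v' hv'
    have hPv := hV.subset v hv
    have hPv' := hV.subset v' hv'
    have hPv'' := hV.subset v'' hv''
    have r1 : (b v).1 * (z v).1 + (b v).2 * (z v).2 = (b v).1 * (z v').1 + (b v).2 * (z v').2 := by
      have := le_antisymm (hV.right_mem hv v' hPv') (hvv ▸ hV.left_mem hv' v hPv)
      rw [← hcast _ v hv, ← hcast _ v' hv'] at this
      exact_mod_cast this
    have r2 : (b v').1 * (z v').1 + (b v').2 * (z v').2 =
        (b v').1 * (z v'').1 + (b v').2 * (z v'').2 := by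
      have := le_antisymm (hV.right_mem hv' v'' hPv'') (hvv' ▸ hV.left_mem hv'' v' hPv')
      rw [← hcast _ v' hv', ← hcast _ v'' hv''] at this
      exact_mod_cast this
    have s1 : hV.succ (a v) = b v := hV.succ_left hv
    have s2 : hV.succ (b v) = b v' := by rw [← hvv, hV.succ_left hv']
    have h1 : h (a v) = (a v).1 * (z v).1 + (a v).2 * (z v).2 := hleft v hv
    have h2 : h (b v) = (b v).1 * (z v').1 + (b v).2 * (z v').2 := by
      rw [← hvv, hleft v' hv']
    have h3 : h (b v') = (b v').1 * (z v').1 + (b v').2 * (z v').2 := by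
      rw [r2, ← hvv', hleft v'' hv'']
    rw [hvv] at c'
    have hsum := hV.isSmoothFan.add_succ_succ (Finset.mem_image_of_mem a hv)
    rw [s1, s2] at hsum
    set l := edgeLen hV.succ h (a v) with hl
    have hl' : l = (a v).1 * ((z v').1 - (z v).1) + (a v).2 * ((z v').2 - (z v).2) := by
      have q1 := congrArg Prod.fst hsum
      have q2 := congrArg Prod.snd hsum
      simp only [Prod.fst_add, Prod.snd_add, Prod.smul_fst, Prod.smul_snd, smul_eq_mul] at q1 q2
      rw [hl, edgeLen, s1, s2, h1, h2, h3]
      linear_combination -(z v').1 * q1 - (z v').2 * q2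
    -- From v to v' the functional `b v` is constant and `a v` increases by l; as the two form a
    -- lattice basis, this determines the difference as l times a primitive vector.
    have hzz : z v' = z v + l • ((b v).2, -(b v).1) := by
      have c0 : (a v).1 * (b v).2 - (a v).2 * (b v).1 = 1 := c
      rw [hl']
      ext
      · simp only [Prod.fst_add, Prod.smul_fst, smul_eq_mul]
        linear_combination -((z v').1 - (z v).1) * c0 + (a v).2 * r1
      · simp only [Prod.snd_add, Prod.smul_snd, smul_eq_mul]
        linear_combination -((z v').2 - (z v).2) * c0 - (a v).1 * r1
    have hl0 : 0 ≤ l := by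
      have := hV.left_mem hv v' hPv'
      rw [← hcast _ v hv, ← hcast _ v' hv'] at this
      have h4 : (a v).1 * (z v).1 + (a v).2 * (z v).2 ≤ (a v).1 * (z v').1 + (a v).2 * (z v').2 := by
        exact_mod_cast this
      rw [hl']; linarith
    have hlne : l ≠ 0 := by
      intro h0
      rw [h0, zero_smul, add_zero] at hzz
      have : v' = v := by rw [← hz v hv, ← hz v' hv', hzz]
      rw [← hvv, this, ldet_self] at c
      exact zero_ne_one c
    have hlpos : 0 < l := lt_of_le_of_ne hl0 hlne.symm
    have hedge := isEdge_latticeFace hP.1.1 (k := h (b v)) c (by rwa [hz v hv])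
      (by rwa [hz v' hv']) hzz hlpos (by rw [hz v hv, ← hcast _ v hv, r1, h2])
      (fun x hx => by
        rw [← hvv, hleft' v' hv']; exact hV.left_mem hv' x hx)
    rw [s1]
    exact ⟨hedge.1, hlpos, hedge.2⟩

/-! ### Areas -/

/-- The coordinates with respect to a lattice basis of functionals. -/
noncomputable def latticeCoords (r t : ℤ × ℤ) (h : ldet r t = 1) :
    (Fin 2 → ℝ) ≃ₗ[ℝ] (Fin 2 → ℝ) where
  toFun x := ![latticePairing r x, latticePairing t x]
  invFun y := ![t.2 * y 0 - r.2 * y 1, r.1 * y 1 - t.1 * y 0]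
  map_add' x y := by
    ext i; fin_cases i <;> simp [latticePairing] <;> ring
  map_smul' k x := by
    ext i; fin_cases i <;> simp [latticePairing] <;> ring
  left_inv x := by
    have h' : (r.1 : ℝ) * t.2 - r.2 * t.1 = 1 := by
      have : r.1 * t.2 - r.2 * t.1 = 1 := h
      exact_mod_cast this
    ext i; fin_cases i
    · simp [latticePairing]; linear_combination x 0 * h'
    · simp [latticePairing]; linear_combination x 1 * h'
  right_inv y := by
    have h' : (r.1 : ℝ) * t.2 - r.2 * t.1 = 1 := by
      have : r.1 * t.2 - r.2 * t.1 = 1 := h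
      exact_mod_cast this
    ext i; fin_cases i
    · simp [latticePairing]; linear_combination y 0 * h'
    · simp [latticePairing]; linear_combination y 1 * h'

lemma volume_preimage_latticeCoords {r t : ℤ × ℤ} (h : ldet r t = 1) (s : Set (Fin 2 → ℝ)) :
    volume (latticeCoords r t h ⁻¹' s) = volume s := by
  have hdet : LinearMap.det (latticeCoords r t h : (Fin 2 → ℝ) →ₗ[ℝ] (Fin 2 → ℝ)) = 1 := by
    have : (latticeCoords r t h : (Fin 2 → ℝ) →ₗ[ℝ] (Fin 2 → ℝ)) =
        Matrix.toLin' !![(r.1 : ℝ), r.2; t.1, t.2] := by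
      ext i j
      fin_cases i <;> fin_cases j <;> simp [latticeCoords, latticePairing]
    rw [this, LinearMap.det_toLin', Matrix.det_fin_two_of]
    have h' : r.1 * t.2 - r.2 * t.1 = 1 := h
    exact_mod_cast h'
  have := Measure.addHaar_preimage_linearMap (volume : Measure (Fin 2 → ℝ))
    (f := (latticeCoords r t h : (Fin 2 → ℝ) →ₗ[ℝ] (Fin 2 → ℝ))) (by rw [hdet]; exact one_ne_zero) s
  rw [hdet] at this
  simpa using this

lemma volume_latticeBox {r t : ℤ × ℤ} (h : ldet r t = 1) (c d A B : ℤ) :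
    volume (latticeBox r t c d A B) = ENNReal.ofReal A * ENNReal.ofReal B := by
  have : latticeBox r t c d A B = latticeCoords r t h ⁻¹'
      Set.Icc ![(c : ℝ), (d : ℝ)] ![(c : ℝ) + A, (d : ℝ) + B] := by
    ext x
    simp [latticeBox, latticeCoords, Pi.le_def]
    tauto
  rw [this, volume_preimage_latticeCoords, Real.volume_Icc_pi]
  simp

lemma volume_triangle_le (L : ℝ) :
    volume {x : Fin 2 → ℝ | 0 ≤ x 0 ∧ 0 ≤ x 1 ∧ x 0 + x 1 ≤ L} ≤ ENNReal.ofReal (L ^ 2 / 2) := by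
  rcases lt_or_ge L 0 with hL | hL
  · have : {x : Fin 2 → ℝ | 0 ≤ x 0 ∧ 0 ≤ x 1 ∧ x 0 + x 1 ≤ L} = ∅ := by
      ext x
      simp only [Set.mem_ofPred_eq, Set.mem_empty_iff_false, iff_false]
      rintro ⟨h1, h2, h3⟩
      linarith
    rw [this, measure_empty]
    exact zero_le
  have hmeas : MeasurableSet {p : ℝ × ℝ | 0 ≤ p.1 ∧ 0 ≤ p.2 ∧ p.1 + p.2 ≤ L} :=
    ((isClosed_le continuous_const continuous_fst).inter
      ((isClosed_le continuous_const continuous_snd).inter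
        (isClosed_le (continuous_fst.add continuous_snd) continuous_const))).measurableSet
  have hpre : {x : Fin 2 → ℝ | 0 ≤ x 0 ∧ 0 ≤ x 1 ∧ x 0 + x 1 ≤ L} =
      MeasurableEquiv.finTwoArrow ⁻¹' {p : ℝ × ℝ | 0 ≤ p.1 ∧ 0 ≤ p.2 ∧ p.1 + p.2 ≤ L} := by
    ext x; simp [MeasurableEquiv.finTwoArrow]
  rw [hpre, (volume_preserving_finTwoArrow ℝ).measure_preimage hmeas.nullMeasurableSet,
    Measure.volume_eq_prod, Measure.prod_apply hmeas]
  have hslice : ∀ x : ℝ, volume (Prod.mk x ⁻¹' {p : ℝ × ℝ | 0 ≤ p.1 ∧ 0 ≤ p.2 ∧ p.1 + p.2 ≤ L}) ≤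
      (Set.Icc 0 L).indicator (fun x => ENNReal.ofReal (L - x)) x := by
    intro x
    by_cases hx : x ∈ Set.Icc 0 L
    · rw [Set.indicator_of_mem hx, ← sub_zero (L - x), ← Real.volume_Icc]
      refine measure_mono fun y hy => ?_
      exact ⟨hy.2.1, by linarith [show x + y ≤ L from hy.2.2]⟩
    · have : (Prod.mk x ⁻¹' {p : ℝ × ℝ | 0 ≤ p.1 ∧ 0 ≤ p.2 ∧ p.1 + p.2 ≤ L}) = ∅ := by
        ext y
        simp only [Set.mem_preimage, Set.mem_ofPred_eq, Set.mem_empty_iff_false, iff_false]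
        rintro ⟨h1, h2, h3⟩
        exact hx ⟨h1, by linarith⟩
      rw [this, measure_empty]
      exact zero_le
  refine (lintegral_mono hslice).trans (le_of_eq ?_)
  rw [lintegral_indicator measurableSet_Icc, ← ofReal_integral_eq_lintegral_ofReal,
    integral_Icc_eq_integral_Ioc, ← intervalIntegral.integral_of_le hL]
  · rw [intervalIntegral.integral_sub (by simp) (by simp)]
    simp only [intervalIntegral.integral_const, integral_id, smul_eq_mul]
    ring_nf
  · exact (by fun_prop : Continuous fun x : ℝ => L - x).integrableOn_Icc
  · exact (ae_restrict_iff' measurableSet_Icc).2 (Filter.Eventually.of_forall fun x hx => by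
      simpa using hx.2)

lemma volume_lattice_triangle_le {r t : ℤ × ℤ} (h : ldet r t = 1) (c d L : ℤ) :
    volume {x : Fin 2 → ℝ | c ≤ latticePairing r x ∧ d ≤ latticePairing t x ∧
      latticePairing r x + latticePairing t x ≤ c + d + L} ≤ ENNReal.ofReal ((L : ℝ) ^ 2 / 2) := by
  refine le_trans (le_of_eq ?_) (volume_triangle_le L)
  conv_rhs => rw [← volume_preimage_latticeCoords h,
    ← measure_preimage_add volume (-(latticeCoords r t h).symm ![(c : ℝ), (d : ℝ)])]
  congr 1
  ext x
  simp only [Set.mem_preimage, Set.mem_ofPred_eq, map_add, map_neg, LinearEquiv.apply_symm_apply]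
  simp only [latticeCoords, LinearEquiv.coe_mk, LinearMap.coe_mk, AddHom.coe_mk, Pi.add_apply,
    Pi.neg_apply, Matrix.cons_val_zero, Matrix.cons_val_one]
  constructor
  · rintro ⟨h1, h2, h3⟩; exact ⟨by linarith, by linarith, by linarith⟩
  · rintro ⟨h1, h2, h3⟩; exact ⟨by linarith, by linarith, by linarith⟩

lemma volume_real_le_of_subset {P Q : Set (Fin 2 → ℝ)} {C : ℝ} (hC : 0 ≤ C) (hPQ : P ⊆ Q)
    (hQ : volume Q ≤ ENNReal.ofReal C) : volume.real P ≤ C :=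
  ENNReal.toReal_le_of_le_ofReal hC ((measure_mono hPQ).trans hQ)

lemma volume_real_le_of_subset_latticeBox {P : Set (Fin 2 → ℝ)} {r t : ℤ × ℤ} {c d A B : ℤ}
    (h : ldet r t = 1) (hA : 0 ≤ A) (hB : 0 ≤ B) (hP : P ⊆ latticeBox r t c d A B) :
    volume.real P ≤ A * B := by
  have hA' : (0 : ℝ) ≤ A := by exact_mod_cast hA
  have hB' : (0 : ℝ) ≤ B := by exact_mod_cast hB
  refine volume_real_le_of_subset (mul_nonneg hA' hB') hP ?_
  rw [volume_latticeBox h, ENNReal.ofReal_mul hA']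

/-- With m = a - 4, it lets half of the main term `4 ^ m * b ^ 2` absorb the correction -a + 4. -/
lemma two_mul_le_four_pow (m : ℕ) : 2 * m ≤ 4 ^ m := by
  induction m with
  | zero => simp
  | succ m ih =>
    have : 1 ≤ 4 ^ m := Nat.one_le_pow _ _ (by norm_num)
    rw [pow_succ]; omega

lemma IsSmoothPolygon.exists_isGreatest_edgeLengths {P : Set (Fin 2 → ℝ)}
    (hP : IsSmoothPolygon P) : ∃ b, IsGreatest (edgeLengths P) b := by
  obtain ⟨U, s, h, hU, -, -, hedge⟩ := hP.exists_isSmoothFan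
  obtain ⟨u, hu⟩ := hU.nonempty
  have hne : (edgeLengths P).Nonempty := ⟨_, _, (hedge u hu).1, rfl⟩
  have hbdd : BddAbove (edgeLengths P) := by
    refine ⟨(P ∩ intLattice 2).ncard, ?_⟩
    rintro _ ⟨F, hF, rfl⟩
    exact (Nat.sub_le _ _).trans (Set.ncard_le_ncard
      (Set.inter_subset_inter_left _ (hF.1.2.subset)) hP.1.1.finite_inter_intLattice)
  exact ⟨_, Nat.sSup_mem hne hbdd, fun _ hx => le_csSup hbdd hx⟩

/-- The area bounds. -/
theorem IsSmoothPolygon.volume_le {P : Set (Fin 2 → ℝ)} (hP : IsSmoothPolygon P) {b : ℕ}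
    (hb : IsGreatest (edgeLengths P) b) :
    (numVertices P = 3 → volume.real P ≤ (1 / 2 : ℝ) * (b : ℝ) ^ 2) ∧
    (numVertices P = 4 → volume.real P ≤ (b : ℝ) ^ 2) ∧
    (5 ≤ numVertices P → volume.real P ≤
      (4 : ℝ) ^ (numVertices P - 4) * (b : ℝ) ^ 2 - (numVertices P : ℝ) + 4) := by
  obtain ⟨U, s, h, hU, hcard, hPU, hedge⟩ := hP.exists_isSmoothFan
  have hlen : ∀ u ∈ U, 1 ≤ edgeLen s h u ∧ edgeLen s h u ≤ b := by
    intro u hu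
    obtain ⟨h1, h2, h3⟩ := hedge u hu
    refine ⟨h2, h3.trans ?_⟩
    exact_mod_cast hb.2 ⟨_, h1, rfl⟩
  rw [← hcard]
  refine ⟨fun hn => ?_, fun hn => ?_, fun hn => ?_⟩
  · obtain ⟨r, hr, t, c, d, hrt, htri⟩ := hU.exists_triangle_of_card_eq_three hn h
    obtain ⟨l1, l2⟩ := hlen r hr
    refine (volume_real_le_of_subset (by positivity) (fun x hx => htri x (hPU hx))
      (volume_lattice_triangle_le hrt c d _)).trans ?_
    have l1' : (1 : ℝ) ≤ edgeLen s h r := by exact_mod_cast l1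
    have l2' : (edgeLen s h r : ℝ) ≤ b := by exact_mod_cast l2
    nlinarith
  · obtain ⟨r, hr, -, -, t, c, d, hrt, hbox⟩ :=
      hU.exists_latticeBox_of_card_eq_four hn fun u hu => (hlen u hu).2
    obtain ⟨l1, l2⟩ := hlen r hr
    refine (volume_real_le_of_subset_latticeBox hrt (by omega) (by omega)
      (hPU.trans hbox)).trans ?_
    have l2' : (edgeLen s h r : ℝ) ≤ b := by exact_mod_cast l2
    rw [sq, Int.cast_natCast]
    exact mul_le_mul_of_nonneg_right l2' b.cast_nonneg
  · obtain ⟨k, hk⟩ := Nat.exists_eq_add_of_le' hn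
    obtain ⟨r, t, c, d, A, B, hrt, hbox, hA, hB, -, -, hAB⟩ :=
      IsSmoothFan.exists_latticeBox_of_five_le_card k hU hk hlen
    refine (volume_real_le_of_subset_latticeBox hrt hA hB (hPU.trans hbox)).trans ?_
    obtain ⟨u, hu⟩ := hU.nonempty
    have hb1 : (1 : ℤ) ≤ b := (hlen u hu).1.trans (hlen u hu).2
    have hb1' : (1 : ℝ) ≤ b := by exact_mod_cast hb1
    have h4 : (2 * (k + 1 : ℕ) : ℝ) ≤ 4 ^ (k + 1) := by exact_mod_cast two_mul_le_four_pow (k + 1)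
    have hAB' : 2 * ((A : ℝ) * B) ≤ 4 ^ (k + 1) * (b : ℝ) ^ 2 := by exact_mod_cast hAB
    have h5 : (4 : ℝ) ^ (k + 1) ≤ 4 ^ (k + 1) * (b : ℝ) ^ 2 :=
      le_mul_of_one_le_right (by positivity) (one_le_pow₀ hb1')
    rw [hk, show k + 5 - 4 = k + 1 by omega]
    push_cast at h4 ⊢
    linarith

/-! ### Bounds from the number of boundary lattice points -/

/-- A point where a nonzero functional is minimal lies on the frontier. -/
lemma mem_frontier_of_forall_le {P : Set (Fin 2 → ℝ)} (f : StrongDual ℝ (Fin 2 → ℝ))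
    {z x : Fin 2 → ℝ} (hz : 0 < f z) (hx : x ∈ P) (hmin : ∀ y ∈ P, f x ≤ f y) :
    x ∈ frontier P := by
  refine ⟨subset_closure hx, fun hint => ?_⟩
  have hc : Continuous fun ε : ℝ => x - ε • z := by fun_prop
  have h1 : ∀ᶠ ε : ℝ in nhds 0, x - ε • z ∈ P :=
    hc.continuousAt.eventually_mem (by simpa using mem_interior_iff_mem_nhds.1 hint)
  have h2 : ∀ᶠ ε : ℝ in nhdsWithin 0 (Set.Ioi 0), x - ε • z ∈ P :=
    h1.filter_mono nhdsWithin_le_nhds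
  obtain ⟨ε, h3, h4⟩ := (h2.and self_mem_nhdsWithin).exists
  have h5 := hmin _ h3
  rw [map_sub, map_smul, smul_eq_mul] at h5
  have := mul_pos (Set.mem_Ioi.1 h4) hz
  linarith

lemma IsSmoothPolygon.finite_frontier_inter {P : Set (Fin 2 → ℝ)} (hP : IsSmoothPolygon P) :
    (frontier P ∩ intLattice 2).Finite :=
  hP.1.1.finite_inter_intLattice.subset
    (Set.inter_subset_inter_left _ hP.1.1.isCompact.isClosed.frontier_subset)

lemma IsSmoothPolygon.numVertices_le {P : Set (Fin 2 → ℝ)} (hP : IsSmoothPolygon P) :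
    numVertices P ≤ numBoundaryLatticePoints P := by
  refine Set.ncard_le_ncard (fun v hv => ⟨?_, hP.1.1.extremePoints_subset hv⟩)
    hP.finite_frontier_inter
  obtain ⟨f, hf⟩ := hP.1.1.exists_lt hv
  -- A second point of P, present because P spans the plane, shows that f is nonzero.
  obtain ⟨x, hx, hxv⟩ : ∃ x ∈ P, x ≠ v := by
    by_contra! hc
    have h1 : affineSpan ℝ P ≤ affineSpan ℝ {v} := affineSpan_mono ℝ hc
    rw [hP.1.2, top_le_iff] at h1
    have h2 : (v + 1 : Fin 2 → ℝ) ∈ affineSpan ℝ {v} := h1 ▸ AffineSubspace.mem_top ℝ _ _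
    rw [AffineSubspace.mem_affineSpan_singleton] at h2
    simpa using congrFun h2 0
  refine mem_frontier_of_forall_le f (z := x - v) ?_ hv.1 fun y hy => ?_
  · rw [map_sub, sub_pos]; exact hf x hx hxv
  · by_cases h : y = v
    · rw [h]
    · exact (hf y hy h).le

lemma latticeBox_mono {r t : ℤ × ℤ} {c d A B A' B' : ℤ} (hA : A ≤ A') (hB : B ≤ B') :
    latticeBox r t c d A B ⊆ latticeBox r t c d A' B' := by
  rintro x ⟨h1, h2, h3, h4⟩
  have hA' : (A : ℝ) ≤ A' := by exact_mod_cast hA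
  have hB' : (B : ℝ) ≤ B' := by exact_mod_cast hB
  exact ⟨h1, by linarith, h3, by linarith⟩

/-- A smooth polygon lies in a lattice square whose size is bounded in terms of the number of
boundary lattice points. -/
lemma IsSmoothPolygon.exists_subset_latticeBox {P : Set (Fin 2 → ℝ)} (hP : IsSmoothPolygon P)
    {N : ℕ} (hN : numBoundaryLatticePoints P = N + 1) :
    ∃ r t c d, ldet r t = 1 ∧ P ⊆ latticeBox r t c d (2 ^ N * N) (2 ^ N * N) := by
  obtain ⟨U, s, h, hU, hcard, hPU, hedge⟩ := hP.exists_isSmoothFan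
  have hn := hP.numVertices_le
  rw [← hcard, hN] at hn
  have hlen : ∀ u ∈ U, 1 ≤ edgeLen s h u ∧ edgeLen s h u ≤ N := by
    intro u hu
    obtain ⟨h1, h2, h3⟩ := hedge u hu
    refine ⟨h2, h3.trans ?_⟩
    -- `s u` is nonzero and minimal along the edge, which therefore lies in the frontier and has at
    -- most N + 1 lattice points.
    have hsub : latticeFace P (s u) (h (s u)) ∩ intLattice 2 ⊆ frontier P ∩ intLattice 2 := by
      refine Set.inter_subset_inter_left _ fun x hx => ?_
      refine mem_frontier_of_forall_le (latticeFunctional (s u))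
        (z := latticeVec (-u.2, u.1)) ?_ hx.1 fun y hy => ?_
      · have : latticePairing (s u) (latticeVec (-u.2, u.1)) = ldet u (s u) := by
          simp [latticePairing, latticeVec, ldet]; ring
        rw [latticeFunctional_apply, this, hU.ldet_eq u hu]
        norm_num
      · rw [latticeFunctional_apply, latticeFunctional_apply, hx.2]
        exact hPU hy _ (hU.mapsTo u hu)
    have := Set.ncard_le_ncard hsub hP.finite_frontier_inter
    rw [numBoundaryLatticePoints] at hN
    rw [hN] at this
    rw [latticeLength]
    omega
  -- One size serves all cases: the exponent is 0 for three or four vertices and a - 4 otherwise,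
  -- and a ≤ N + 1.
  have hbig : ∀ m ≤ N, (2 : ℤ) ^ m * N ≤ 2 ^ N * N := fun m hm =>
    mul_le_mul_of_nonneg_right (pow_le_pow_right₀ (by norm_num) hm) (by positivity)
  have h0 := hbig 0 (Nat.zero_le N)
  rw [pow_zero, one_mul] at h0
  rcases (hU.three_le_card).eq_or_lt with h3 | h3
  · obtain ⟨r, hr, t, c, d, hrt, htri⟩ := hU.exists_triangle_of_card_eq_three h3.symm h
    obtain ⟨l1, l2⟩ := hlen r hr
    refine ⟨r, t, c, d, hrt, fun x hx => ?_⟩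
    obtain ⟨t1, t2, t3⟩ := htri x (hPU hx)
    exact latticeBox_mono (l2.trans h0) (l2.trans h0) ⟨t1, by linarith, t2, by linarith⟩
  rcases (Nat.succ_le_of_lt h3).eq_or_lt with h4 | h4
  · obtain ⟨r, hr, -, -, t, c, d, hrt, hbox⟩ :=
      hU.exists_latticeBox_of_card_eq_four h4.symm fun u hu => (hlen u hu).2
    exact ⟨r, t, c, d, hrt,
      (hPU.trans hbox).trans (latticeBox_mono ((hlen r hr).2.trans h0) h0)⟩
  · obtain ⟨k, hk⟩ := Nat.exists_eq_add_of_le' (show 5 ≤ U.card by omega)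
    obtain ⟨r, t, c, d, A, B, hrt, hbox, -, -, hA, hB, -⟩ :=
      IsSmoothFan.exists_latticeBox_of_five_le_card k hU hk hlen
    have h1 := hbig (k + 1) (by omega)
    exact ⟨r, t, c, d, hrt, (hPU.trans hbox).trans (latticeBox_mono (hA.trans h1) (hB.trans h1))⟩

/-! ### Finiteness up to integral equivalence -/

lemma latticeCoords_mem_iff {r t : ℤ × ℤ} (h : ldet r t = 1) (x : Fin 2 → ℝ) :
    latticeCoords r t h x ∈ intLattice 2 ↔ x ∈ intLattice 2 := by
  constructor
  · intro hx
    obtain ⟨w, hw⟩ := exists_latticeVec_eq hx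
    rw [← (latticeCoords r t h).symm_apply_apply x, ← hw]
    have : (latticeCoords r t h).symm (latticeVec w) =
        latticeVec (t.2 * w.1 - r.2 * w.2, r.1 * w.2 - t.1 * w.1) := by
      ext i; fin_cases i <;> simp [latticeCoords, latticeVec]
    rw [this]
    exact latticeVec_mem _
  · intro hx
    obtain ⟨w, rfl⟩ := exists_latticeVec_eq hx
    have : latticeCoords r t h (latticeVec w) =
        latticeVec (r.1 * w.1 + r.2 * w.2, t.1 * w.1 + t.2 * w.2) := by
      ext i; fin_cases i <;> simp [latticeCoords, latticeVec, latticePairing]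
    rw [this]
    exact latticeVec_mem _

lemma add_latticeVec_mem_iff (w : ℤ × ℤ) (x : Fin 2 → ℝ) :
    latticeVec w + x ∈ intLattice 2 ↔ x ∈ intLattice 2 := by
  have key : ∀ (w : ℤ × ℤ) (x : Fin 2 → ℝ), x ∈ intLattice 2 →
      latticeVec w + x ∈ intLattice 2 := by
    intro w x hx
    obtain ⟨y, rfl⟩ := exists_latticeVec_eq hx
    have : latticeVec w + latticeVec y = latticeVec (w + y) := by
      ext i; fin_cases i <;> simp [latticeVec]
    rw [this]
    exact latticeVec_mem _
  refine ⟨fun h => ?_, key w x⟩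
  have := key (-w) _ h
  have h0 : latticeVec (-w) + (latticeVec w + x) = x := by
    ext i; fin_cases i <;> simp [latticeVec, Matrix.vecHead, Matrix.vecTail]
  rwa [h0] at this

/-- The lattice points of the square `[0, K]²`. -/
def squareLatticePoints (K : ℕ) : Set (Fin 2 → ℝ) :=
  Set.Icc 0 (fun _ => (K : ℝ)) ∩ intLattice 2

lemma finite_squareLatticePoints (K : ℕ) : (squareLatticePoints K).Finite := by
  refine ((Set.finite_Icc (0 : Fin 2 → ℤ) (fun _ => (K : ℤ))).image
    (fun (z : Fin 2 → ℤ) (i : Fin 2) => (z i : ℝ))).subset ?_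
  rintro _ ⟨⟨h1, h2⟩, z, rfl⟩
  refine ⟨z, ⟨fun i => ?_, fun i => ?_⟩, rfl⟩
  · have := h1 i
    simpa using this
  · have := h2 i
    simp only at this
    exact_mod_cast this

/-- Up to a unimodular affine map, a smooth polygon is spanned by points of a fixed finite set. -/
lemma IsSmoothPolygon.exists_affineEquiv {P : Set (Fin 2 → ℝ)} (hP : IsSmoothPolygon P)
    {N : ℕ} (hN : numBoundaryLatticePoints P = N + 1) :
    ∃ φ : (Fin 2 → ℝ) ≃ᵃ[ℝ] (Fin 2 → ℝ), (∀ x, φ x ∈ intLattice 2 ↔ x ∈ intLattice 2) ∧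
      ∃ W ⊆ squareLatticePoints (2 ^ N * N), φ '' P = convexHull ℝ W := by
  obtain ⟨r, t, c, d, hrt, hbox⟩ := hP.exists_subset_latticeBox hN
  set φ : (Fin 2 → ℝ) ≃ᵃ[ℝ] (Fin 2 → ℝ) := (latticeCoords r t hrt).toAffineEquiv.trans
    (AffineEquiv.constVAdd ℝ (Fin 2 → ℝ) (latticeVec (-c, -d))) with hφ
  have hφx : ∀ x, φ x = latticeVec (-c, -d) + latticeCoords r t hrt x := fun x => rfl
  have hφL : ∀ x, φ x ∈ intLattice 2 ↔ x ∈ intLattice 2 := fun x => by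
    rw [hφx, add_latticeVec_mem_iff, latticeCoords_mem_iff]
  refine ⟨φ, hφL, φ '' P.extremePoints ℝ, ?_, ?_⟩
  · rintro _ ⟨v, hv, rfl⟩
    obtain ⟨h1, h2, h3, h4⟩ := hbox hv.1
    push_cast at h2 h4
    refine ⟨⟨fun i => ?_, fun i => ?_⟩, (hφL v).2 (hP.1.1.extremePoints_subset hv)⟩
    · rw [hφx]
      fin_cases i <;> simp [latticeVec, latticeCoords] <;> linarith
    · rw [hφx]
      fin_cases i <;> simp [latticeVec, latticeCoords] <;> linarith
  · have := AffineMap.image_convexHull (𝕜 := ℝ) (φ : (Fin 2 → ℝ) →ᵃ[ℝ] (Fin 2 → ℝ))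
      (P.extremePoints ℝ)
    rw [hP.1.1.convexHull_extremePoints] at this
    exact this

lemma integrallyEquivalent_of_image_eq {P Q : Set (Fin 2 → ℝ)} (hP : affineSpan ℝ P = ⊤)
    (hQ : affineSpan ℝ Q = ⊤) {φ ψ : (Fin 2 → ℝ) ≃ᵃ[ℝ] (Fin 2 → ℝ)}
    (hφ : ∀ x, φ x ∈ intLattice 2 ↔ x ∈ intLattice 2)
    (hψ : ∀ x, ψ x ∈ intLattice 2 ↔ x ∈ intLattice 2) (h : φ '' P = ψ '' Q) :
    IntegrallyEquivalent P Q := by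
  set χ := φ.trans ψ.symm with hχ
  have hχx : ∀ x, ψ (χ x) = φ x := fun x => by simp [hχ]
  have hχL : ∀ x, χ x ∈ intLattice 2 ↔ x ∈ intLattice 2 := fun x => by
    rw [← hψ, hχx, hφ]
  refine ⟨χ, ?_, ?_⟩
  · rw [hP, hQ]
    simp only [AffineSubspace.top_coe, Set.inter_univ]
    refine ⟨fun x hx => (hχL x).2 hx, χ.injective.injOn, fun y hy => ?_⟩
    exact ⟨χ.symm y, (hχL _).1 (by simpa using hy), by simp⟩
  · ext y
    constructor
    · rintro ⟨x, hx, rfl⟩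
      obtain ⟨z, hz, hzx⟩ := h ▸ Set.mem_image_of_mem φ hx
      have : χ x = z := ψ.injective ((hχx x).trans hzx.symm)
      change χ x ∈ Q
      rwa [this]
    · intro hy
      obtain ⟨x, hx, hxy⟩ := h.symm ▸ Set.mem_image_of_mem ψ hy
      exact ⟨x, hx, ψ.injective ((hχx x).trans hxy)⟩

/-- There are only finitely many smooth polygons with a given number of boundary lattice points. -/
theorem exists_finite_representatives (N : ℕ) : ∃ T : Set (Set (Fin 2 → ℝ)), T.Finite ∧
    (∀ Q ∈ T, IsSmoothPolygon Q ∧ numBoundaryLatticePoints Q = N + 1) ∧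
    ∀ P : Set (Fin 2 → ℝ), IsSmoothPolygon P → numBoundaryLatticePoints P = N + 1 →
      ∃ Q ∈ T, IntegrallyEquivalent P Q := by
  set S : Set (Set (Fin 2 → ℝ)) :=
    {P | IsSmoothPolygon P ∧ numBoundaryLatticePoints P = N + 1} with hS
  choose! φ hφ W hW hφW using
    fun P (hP : P ∈ S) => IsSmoothPolygon.exists_affineEquiv hP.1 hP.2
  set F : Set (Fin 2 → ℝ) → Set (Fin 2 → ℝ) := fun P => φ P '' P with hF
  have hfin : (F '' S).Finite := by
    refine ((finite_squareLatticePoints (2 ^ N * N)).finite_subsets.image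
      (convexHull ℝ : Set (Fin 2 → ℝ) → Set (Fin 2 → ℝ))).subset ?_
    rintro _ ⟨P, hP, rfl⟩
    exact ⟨W P, hW P hP, (hφW P hP).symm⟩
  -- The normalised images form a finite set. One original polygon is chosen for each image, so the
  -- representatives belong to S by construction.
  refine ⟨Function.invFunOn F S '' (F '' S), hfin.image _, ?_, fun P hP hPN => ?_⟩
  · rintro _ ⟨_, hQ, rfl⟩
    exact Function.invFunOn_mem hQ
  · have hPS : P ∈ S := ⟨hP, hPN⟩
    have hmem := Set.mem_image_of_mem F hPS
    have hQS : Function.invFunOn F S (F P) ∈ S := Function.invFunOn_mem hmem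
    exact ⟨_, Set.mem_image_of_mem _ hmem, integrallyEquivalent_of_image_eq hP.1.2 hQS.1.1.2
      (hφ P hPS) (hφ _ hQS) (Function.invFunOn_eq hmem).symm⟩

theorem mainTheorem8 :
    (∀ N : ℕ, ∃ T : Set (Set (Fin 2 → ℝ)), T.Finite ∧
      (∀ Q ∈ T, IsSmoothPolygon Q ∧ numBoundaryLatticePoints Q = N + 1) ∧
      ∀ P : Set (Fin 2 → ℝ), IsSmoothPolygon P → numBoundaryLatticePoints P = N + 1 →
        ∃ Q ∈ T, IntegrallyEquivalent P Q) ∧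
    (∀ P : Set (Fin 2 → ℝ), IsSmoothPolygon P →
      ∃ b : ℕ, IsGreatest (edgeLengths P) b ∧
        (numVertices P = 3 → volume.real P ≤ (1 / 2 : ℝ) * (b : ℝ) ^ 2) ∧
        (numVertices P = 4 → volume.real P ≤ (b : ℝ) ^ 2) ∧
        (5 ≤ numVertices P →
          volume.real P ≤
            (4 : ℝ) ^ (numVertices P - 4) * (b : ℝ) ^ 2 - (numVertices P : ℝ) + 4)) := by
  refine ⟨exists_finite_representatives, fun P hP => ?_⟩
  obtain ⟨b, hb⟩ := hP.exists_isGreatest_edgeLengths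
  exact ⟨b, hb, hP.volume_le hb⟩
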